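/- **Notation.** Let $S$ be a left cancellative monoid with identity $e$ and group of units $S^*$. On $\ell^2(S)$ let $\lambda_s\delta_t=\delta_{st}$, and let $C^*_r(S)$ be the C$^*$-algebra generated by the operators $\lambda_s$, $s\in S$. Let $I_\ell(S)$ be the left inverse hull of $S$, that is, the inverse semigroup of partial bijections of $S$ generated by the left translations $t\mapsto st$. Let $\mathcal J(S)$ be the set of constructible right ideals, i.e. of the sets $X\subset S$ such that the identity map $p_X$ on $X$ belongs to $I_\ell(S)$; thus $E(S)=\{p_X\mid X\in\mathcal J(S)\}$ is the semilattice of idempotents of $I_\ell(S)$. A semi-character of $E(S)$ is a nonzero multiplicative map $\chi\colon E(S)\to\{0,1\}$; semi-characters carry the topology of pointwise convergence. For $s\in S$ put $\chi_s(p_X)=\mathbf 1_X(s)$, and let $\Omega(S)=\overline{\{\chi_s\mid s\in S\}}$. *The groupoids.* The étale groupoid $\mathcal G_P(S)$ consists of the classes $[g,\chi]$ of pairs $g\in I_\ell(S)$, $\chi\in\Omega(S)$ with $\chi(g^{-1}g)=1$, where $[g,\chi]=[h,\psi]$ if and only if $\chi=\psi$ and $gp=hp$ for some $p\in E(S)$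 with $\chi(p)=1$. The groupoid $\mathcal G(S)$ consists of the classes of the same pairs for the coarser relation: $[g,\chi]=[h,\psi]$ if and only if $\chi=\psi$ and there are $X,X_1,\dots,X_m\in\mathcal J(S)$, $m\ge0$, such that $\chi(p_X)=1$, $\chi(p_{X_i})=0$ for all $i$, and $g$ and $h$ are defined and equal on $X\setminus\bigcup_{i=1}^mX_i$. In both cases the source and range of $[g,\chi]$ are $\chi$ and $\chi(g^{-1}\cdot g)$, the product is $[g,\chi][h,\psi]=[gh,\psi]$ if $\chi=\psi(h^{-1}\cdot h)$, the inverse of $[g,\chi]$ is $[g^{-1},\chi(g^{-1}\cdot g)]$, the unit space is $\Omega(S)$, where $\chi$ is identified with $[p_S,\chi]$, and the sets $D(g,U)=\{[g,\chi]\mid\chi\in U\}$, with $U$ an open subset of $\{\chi\in\Omega(S)\mid\chi(g^{-1}g)=1\}$, form a basis of the topology. *The groupoid C$^*$-algebras.* For an étale groupoid $\mathcal G$ with locally compact Hausdorff unit space, let $C_c(\mathcal G)$ be the span of the functions on $\mathcal G$ that vanish outside an open bisection $U$ and whose restriction to $U$ is continuous and compactly supported. For $x\in\mathcal G^{(0)}$,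 let $\rho_x$ be the representation of $C_c(\mathcal G)$ on $\ell^2(\mathcal G_x)$, $\mathcal G_x=s^{-1}(x)$, given by $(\rho_x(f)\xi)(g)=\sum_{h\in\mathcal G^{r(g)}}f(h)\xi(h^{-1}g)$, where $\mathcal G^{y}=r^{-1}(y)$. Then $C^*_r(\mathcal G)$ is the completion of $C_c(\mathcal G)$ in the norm $\|f\|_r=\sup_x\|\rho_x(f)\|$, and $\rho_x$ extends to $C^*_r(\mathcal G)$. The set $J_{\mathrm{sing}}$ of all $a\in C^*_r(\mathcal G)$ such that $\{x\in\mathcal G^{(0)}\mid\rho_x(a)\delta_x\ne0\}$ is meager is a closed two-sided ideal, and $C^*_{\mathrm{ess}}(\mathcal G)=C^*_r(\mathcal G)/J_{\mathrm{sing}}$. For $\mathcal G=\mathcal G_P(S)$ or $\mathcal G=\mathcal G(S)$, the map $S\to\mathcal G_{\chi_e}$, $s\mapsto[s,\chi_e]$, where $s\in S$ is identified with the left translation by $s$, is a bijection, and we use it to view $\rho_{\chi_e}$ as a representation on $\ell^2(S)$. **Proposition 2.13.** Let $S$ be a countable left cancellative monoid. Assume that for every unit $u\in S^*$, $u\ne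 e$, there are $X_1,\dots,X_m\in\mathcal J(S)$, $m\ge0$, such that $\bigcup_{i=1}^mX_i\ne S$ and $us\ne s$ for all $s\notin\bigcup_{i=1}^mX_i$. Then $\rho_{\chi_e}$ maps $C^*_r(\mathcal G_P(S))$ and $C^*_r(\mathcal G(S))$ into $C^*_r(S)$, and the maps $\rho_{\chi_e}\colon C^*_r(\mathcal G_P(S))\to C^*_r(S)$ and $\rho_{\chi_e}\colon C^*_r(\mathcal G(S))\to C^*_r(S)$ factor through $*$-isomorphisms $$ C^*_{\mathrm{ess}}(\mathcal G_P(S))\cong C^*_r(S)\cong C^*_{\mathrm{ess}}(\mathcal G(S)). $$ -/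

import Mathlib

open Set Topology
open scoped ENNReal

/-! ### Étale groupoids -/

/-- A locally compact étale groupoid with space of arrows `G` and unit space `X` (embedded in `G`
by `one`).  `mul g h _` is the product `g h`, defined when the source of `g` is the range of `h`.
`G` is not assumed Hausdorff; `X` is locally compact Hausdorff, and so `G` is locally compact. -/
structure EtaleGroupoid (G X : Type*) [TopologicalSpace G] [TopologicalSpace X] where
  src : G → X
  rng : G → X
  one : X → G
  inv : G → G
  mul : (g h : G) → src g = rng h → G
  src_one : ∀ x, src (one x) = x
  rng_one : ∀ x, rng (one x) = x
  src_inv : ∀ g, src (inv g) = rng g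
  rng_inv : ∀ g, rng (inv g) = src g
  src_mul : ∀ g h H, src (mul g h H) = src h
  rng_mul : ∀ g h H, rng (mul g h H) = rng g
  mul_assoc : ∀ g h k (H : src g = rng h) (K : src h = rng k),
    mul (mul g h H) k ((src_mul g h H).trans K) = mul g (mul h k K) (H.trans (rng_mul h k K).symm)
  one_mul : ∀ g, mul (one (rng g)) g (src_one _) = g
  mul_one : ∀ g, mul g (one (src g)) (rng_one _).symm = g
  inv_mul : ∀ g, mul (inv g) g (src_inv g) = one (src g)
  mul_inv : ∀ g, mul g (inv g) (rng_inv g).symm = one (rng g)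
  t2Space : T2Space X
  locallyCompactSpace : LocallyCompactSpace X
  isLocalHomeomorph_src : IsLocalHomeomorph src
  isLocalHomeomorph_rng : IsLocalHomeomorph rng
  continuous_one : Continuous one
  continuous_inv : Continuous inv
  continuous_mul :
    Continuous fun p : {p : G × G // src p.1 = rng p.2} => mul p.1.1 p.1.2 p.2

/-! ### Left inverse hull, constructible ideals, semi-characters -/

namespace LCMonoid

/-- The idempotent `p_X`: the identity map with domain `X`. -/
noncomputable def idOn {S : Type*} (X : Set S) : S ≃. S := open Classical in PEquiv.ofSet X

theorem idOn_eq_some {S : Type*} (X : Set S) (a b : S) : idOn X a = some b ↔ a = b ∧ a ∈ X := by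
  unfold idOn; exact PEquiv.ofSet_eq_some_iff.trans (by aesop)

variable {S : Type*} [LeftCancelMonoid S]

/-- The left translation `t ↦ s t`, as a partial bijection of `S` with domain `S` and
range `s S`. -/
noncomputable def leftMul (s : S) : S ≃. S where
  toFun t := some (s * t)
  invFun r := open Classical in if h : ∃ t, s * t = r then some h.choose else none
  inv a b := by
    classical
    by_cases h : ∃ t, s * t = b
    · have := h.choose_spec
      simp only [h, ↓reduceDIte, Option.some.injEq]
      constructor
      · rintro rfl; exact this
      · intro h2; exact mul_left_cancel (this.trans h2.symm)
    · simp only [h, ↓reduceDIte, Option.some.injEq, reduceCtorEq, false_iff]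
      exact fun h2 => h ⟨a, h2⟩

/-- The left inverse hull `I_ℓ(S)` of `S`, as a set of partial bijections: the smallest set
containing the left translations and closed under composition and inversion
(`h.trans g` is `g ∘ h`). -/
inductive InHull : (S ≃. S) → Prop
  | leftMul (s : S) : InHull (leftMul s)
  | comp (g h : S ≃. S) : InHull g → InHull h → InHull (h.trans g)
  | symm (g : S ≃. S) : InHull g → InHull g.symm

variable (S) in
/-- The left inverse hull `I_ℓ(S)`. -/
def Hull : Type _ := {g : S ≃. S // InHull g}

namespace Hull

/-- The element of `I_ℓ(S)` given by the left translation by `s`. -/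
noncomputable def of (s : S) : Hull S := ⟨leftMul s, .leftMul s⟩

/-- The product `g h` is the composition `g ∘ h` of partial maps. -/
instance : Mul (Hull S) := ⟨fun g h => ⟨h.1.trans g.1, .comp _ _ g.2 h.2⟩⟩

instance : Inv (Hull S) := ⟨fun g => ⟨g.1.symm, .symm _ g.2⟩⟩

theorem leftMul_one : leftMul (1 : S) = PEquiv.refl S := by
  ext a b; simp [leftMul, PEquiv.refl]

noncomputable instance : One (Hull S) := ⟨of 1⟩

theorem one_val : (1 : Hull S).1 = PEquiv.refl S := leftMul_one

@[ext] theorem ext' {g h : Hull S} (H : ∀ t, g.1 t = h.1 t) : g = h := Subtype.ext (PEquiv.ext H)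

theorem mul_assoc' (g h k : Hull S) : g * h * k = g * (h * k) :=
  Subtype.ext (PEquiv.trans_assoc k.1 h.1 g.1).symm

theorem mul_apply (g h : Hull S) (t : S) : (g * h).1 t = (h.1 t).bind g.1 := rfl

theorem inv_eq_some (g : Hull S) {t r : S} : g⁻¹.1 r = some t ↔ g.1 t = some r :=
  PEquiv.eq_some_iff g.1

end Hull

variable (S) in
/-- The semilattice `𝒥(S)` of constructible right ideals of `S`: the sets `X ⊆ S` such that the
identity map `p_X` of `X` belongs to `I_ℓ(S)`.  Thus `X ↦ p_X` identifies `𝒥(S)`, with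
intersection, with the semigroup `E(S)` of idempotents of `I_ℓ(S)`. -/
def CIdeal : Type _ := {X : Set S // InHull (idOn X)}

namespace CIdeal

instance : SetLike (CIdeal S) S := ⟨Subtype.val, Subtype.val_injective⟩

/-- The intersection `X ∩ Y`, corresponding to the product `p_X p_Y`. -/
instance : Min (CIdeal S) := ⟨fun X Y => ⟨X.1 ∩ Y.1, by
  have : idOn (X.1 ∩ Y.1) = (idOn Y.1).trans (idOn X.1) := by
    ext a b
    simp only [PEquiv.trans_eq_some, idOn_eq_some, mem_inter_iff]
    aesop
  rw [this]; exact .comp _ _ X.2 Y.2⟩⟩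

theorem mem_inf (X Y : CIdeal S) (t : S) : t ∈ X ⊓ Y ↔ t ∈ X ∧ t ∈ Y := Iff.rfl

end CIdeal

namespace Hull

/-- The preimage `g⁻¹(X)` of a set under a partial bijection. -/
def preimage (g : Hull S) (A : Set S) : Set S := {t | ∃ r ∈ A, g.1 t = some r}

/-- The preimage `g⁻¹(X)` of a constructible ideal, with idempotent `g⁻¹ p_X g`. -/
def preim (g : Hull S) (X : CIdeal S) : CIdeal S := ⟨g.preimage X, by
  have : idOn (g.preimage X) = (g.1.trans (idOn X.1)).trans g.1.symm := by
    ext a b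
    simp only [PEquiv.trans_eq_some, idOn_eq_some, PEquiv.eq_some_iff, preimage,
      mem_ofPred_eq]
    constructor
    · rintro ⟨rfl, r, hr, h⟩; exact ⟨r, ⟨r, h, rfl, hr⟩, h⟩
    · rintro ⟨r, ⟨r', h, rfl, hr⟩, h2⟩; exact ⟨g.1.inj h h2, _, hr, h⟩
  rw [this]; exact .comp _ _ (.symm _ g.2) (.comp _ _ X.2 g.2)⟩

theorem mem_preim (g : Hull S) (X : CIdeal S) (t : S) :
    t ∈ g.preim X ↔ ∃ r ∈ X, g.1 t = some r := Iff.rfl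

/-- The domain of definition of `g`, a constructible ideal with idempotent `g⁻¹ g`. -/
def dom (g : Hull S) : CIdeal S := ⟨{t | ∃ r, g.1 t = some r}, by
  have : idOn {t | ∃ r, g.1 t = some r} = g.1.trans g.1.symm := by
    ext a b
    simp only [PEquiv.trans_eq_some, idOn_eq_some, PEquiv.eq_some_iff,
      mem_ofPred_eq]
    constructor
    · rintro ⟨rfl, r, h⟩; exact ⟨r, h, h⟩
    · rintro ⟨r, h, h2⟩; exact ⟨g.1.inj h h2, _, h⟩
  rw [this]; exact .comp _ _ (.symm _ g.2) g.2⟩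

theorem mem_dom (g : Hull S) (t : S) : t ∈ g.dom ↔ ∃ r, g.1 t = some r := Iff.rfl

end Hull

variable (S) in
/-- The space of semi-characters of `E(S) ≅ 𝒥(S)`: semigroup homomorphisms to `({0, 1}, ·)` that
are not identically zero, with the topology of pointwise convergence. -/
def SemiChar : Type _ :=
  {χ : CIdeal S → Bool // (∀ X Y, χ (X ⊓ Y) = (χ X && χ Y)) ∧ ∃ X, χ X = true}

instance : TopologicalSpace (SemiChar S) := instTopologicalSpaceSubtype

/-- The semi-character `χ_s`, with `χ_s(p_X) = 1` if and only if `s ∈ X`. -/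
noncomputable def pointChar (s : S) : SemiChar S :=
  ⟨fun X => open Classical in decide (s ∈ X), by
    refine ⟨fun X Y => ?_, (1 : Hull S).dom, ?_⟩
    · rw [Bool.eq_iff_iff, Bool.and_eq_true]
      simp only [decide_eq_true_eq, CIdeal.mem_inf]
    · simp [Hull.mem_dom, Hull.one_val]⟩

variable (S) in
/-- The closure `Ω(S)` of the set of the semi-characters `χ_s`, `s ∈ S` (which is the orbit of
`χ_e`). -/
def Omega : Type _ := {χ : SemiChar S // χ ∈ closure (range (pointChar (S := S)))}

instance : TopologicalSpace (Omega S) := instTopologicalSpaceSubtype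

namespace Omega

instance : CoeFun (Omega S) fun _ => CIdeal S → Bool := ⟨fun χ => χ.1.1⟩

@[ext] theorem ext' {χ ψ : Omega S} (h : ∀ X, χ X = ψ X) : χ = ψ :=
  Subtype.ext (Subtype.ext (funext h))

/-- The point `χ_s` of `Ω(S)`. -/
noncomputable def pt (s : S) : Omega S := ⟨pointChar s, subset_closure ⟨s, rfl⟩⟩

theorem pt_apply (s : S) (X : CIdeal S) : pt s X = true ↔ s ∈ X := by
  simp [pt, pointChar]

theorem continuous_apply (X : CIdeal S) : Continuous fun χ : Omega S => χ X :=
  (_root_.continuous_apply X).comp (continuous_subtype_val.comp continuous_subtype_val)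

theorem isClopen_setOf (X : CIdeal S) : IsClopen {χ : Omega S | χ X = true} :=
  (isClopen_discrete {true}).preimage (continuous_apply X)

theorem exists_pt_of_mem_closure {χ : SemiChar S} (h : χ ∈ closure (range (pointChar (S := S))))
    (F : Finset (CIdeal S)) : ∃ s : S, ∀ X ∈ F, χ.1 X = true ↔ s ∈ X := by
  have hU : IsOpen {ψ : SemiChar S | ∀ X ∈ F, ψ.1 X = χ.1 X} := by
    have : {ψ : SemiChar S | ∀ X ∈ F, ψ.1 X = χ.1 X} = ⋂ X ∈ F, {ψ | ψ.1 X = χ.1 X} := by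
      ext; simp
    rw [this]
    refine isOpen_biInter_finset fun X _ => ?_
    have hc : Continuous fun ψ : SemiChar S => ψ.1 X :=
      (_root_.continuous_apply X).comp continuous_subtype_val
    exact (isOpen_discrete {χ.1 X}).preimage hc
  obtain ⟨_, h1, s, rfl⟩ := mem_closure_iff.1 h _ hU fun _ _ => rfl
  refine ⟨s, fun X hX => ?_⟩
  rw [← h1 X hX]; simp [pointChar]

theorem exists_pt (χ : Omega S) (F : Finset (CIdeal S)) :
    ∃ s : S, ∀ X ∈ F, χ X = true ↔ s ∈ X := exists_pt_of_mem_closure χ.2 F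

theorem mem_closure_of {χ : SemiChar S}
    (h : ∀ F : Finset (CIdeal S), ∃ s : S, ∀ X ∈ F, χ.1 X = true ↔ s ∈ X) :
    χ ∈ closure (range (pointChar (S := S))) := by
  have hi : IsInducing (fun χ : SemiChar S => χ.1) := ⟨rfl⟩
  rw [hi.closure_eq_preimage_closure_image, mem_preimage, mem_closure_iff]
  intro U hU hχ
  obtain ⟨F, u, hu, hsub⟩ := isOpen_pi_iff.1 hU _ hχ
  obtain ⟨s, hs⟩ := h F
  refine ⟨(pointChar s).1, hsub fun X hX => ?_, _, ⟨s, rfl⟩, rfl⟩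
  have : (pointChar s).1 X = χ.1 X := by
    rw [Bool.eq_iff_iff, hs X hX]; simp [pointChar]
  rw [this]; exact (hu X hX).2

theorem map_inf (χ : Omega S) (X Y : CIdeal S) : χ (X ⊓ Y) = true ↔ χ X = true ∧ χ Y = true := by
  rw [χ.1.2.1, Bool.and_eq_true]

theorem map_mono (χ : Omega S) {X Y : CIdeal S} (h : ∀ t ∈ X, t ∈ Y) (hX : χ X = true) :
    χ Y = true := by
  have : X ⊓ Y = X := SetLike.ext fun t =>
    (CIdeal.mem_inf X Y t).trans ⟨fun H => H.1, fun H => ⟨H, h t H⟩⟩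
  rw [← this, map_inf] at hX; exact hX.2

theorem map_dom_one (χ : Omega S) : χ (1 : Hull S).dom = true := by
  obtain ⟨X, hX⟩ := χ.1.2.2
  exact χ.map_mono (fun t _ => by simp [Hull.mem_dom, Hull.one_val]) hX

/-- For `g ∈ I_ℓ(S)` and `χ` with `χ(g⁻¹ g) = 1`, the semi-character `χ(g⁻¹ · g)`. -/
def act (g : Hull S) (χ : Omega S) (h : χ g.dom = true) : Omega S :=
  ⟨⟨fun X => χ (g.preim X), by
    refine ⟨fun X Y => ?_, g⁻¹.dom, ?_⟩
    · rw [← χ.1.2.1]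
      refine congrArg χ.1.1 (SetLike.ext fun t => ?_)
      simp only [CIdeal.mem_inf, Hull.mem_preim]
      constructor
      · rintro ⟨r, hr, h⟩; exact ⟨⟨r, hr.1, h⟩, r, hr.2, h⟩
      · rintro ⟨⟨r, hr, h⟩, r', hr', h'⟩
        rw [h] at h'; cases h'; exact ⟨r, ⟨hr, hr'⟩, h⟩
    · refine χ.map_mono (fun t ht => ?_) h
      obtain ⟨r, hr⟩ := ht
      exact ⟨r, ⟨t, (Hull.inv_eq_some g).2 hr⟩, hr⟩⟩, by
    classical
    refine mem_closure_of fun F => ?_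
    obtain ⟨s, hs⟩ := χ.exists_pt (insert g.dom (F.image g.preim))
    obtain ⟨r, hr⟩ := (hs _ (Finset.mem_insert_self _ _)).1 h
    refine ⟨r, fun X hX => ?_⟩
    refine (hs _ (Finset.mem_insert_of_mem (Finset.mem_image_of_mem _ hX))).trans ?_
    rw [Hull.mem_preim]
    constructor
    · rintro ⟨r', h1, h2⟩; rw [hr] at h2; cases h2; exact h1
    · exact fun h => ⟨r, h, hr⟩⟩

theorem act_apply (g : Hull S) (χ : Omega S) (h) (X : CIdeal S) :
    act g χ h X = χ (g.preim X) := rfl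

theorem dom_inv_act (g : Hull S) (χ : Omega S) (h : χ g.dom = true) :
    act g χ h g⁻¹.dom = true := by
  refine χ.map_mono (fun t ht => ?_) h
  obtain ⟨r, hr⟩ := ht
  exact ⟨r, ⟨t, (Hull.inv_eq_some g).2 hr⟩, hr⟩

theorem act_inv_act (g : Hull S) (χ : Omega S) (h : χ g.dom = true) :
    act g⁻¹ (act g χ h) (dom_inv_act g χ h) = χ := by
  ext X
  rw [act_apply, act_apply, Bool.eq_iff_iff]
  have : g.preim (g⁻¹.preim X) = X ⊓ g.dom := by
    refine SetLike.ext fun t => ?_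
    simp only [CIdeal.mem_inf, Hull.mem_preim, Hull.mem_dom, Hull.inv_eq_some]
    constructor
    · rintro ⟨r, ⟨t', h1, h2⟩, h3⟩
      cases g.1.inj h2 h3; exact ⟨h1, r, h3⟩
    · rintro ⟨h1, r, h2⟩; exact ⟨r, ⟨t, h1, h2⟩, h2⟩
  rw [this, map_inf]; simp [h]

theorem mul_dom (g h : Hull S) : (g * h).dom = h.preim g.dom := by
  refine SetLike.ext fun t => ?_
  simp only [Hull.mem_dom, Hull.mem_preim, Hull.mul_apply, Option.bind_eq_some_iff]
  constructor
  · rintro ⟨r, a, h1, h2⟩; exact ⟨a, ⟨r, h2⟩, h1⟩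
  · rintro ⟨a, ⟨r, h2⟩, h1⟩; exact ⟨r, a, h1, h2⟩

theorem act_mul (g h : Hull S) (χ : Omega S) (hh : χ h.dom = true)
    (hg : act h χ hh g.dom = true) :
    act (g * h) χ (by rw [mul_dom]; exact hg) = act g (act h χ hh) hg := by
  ext X
  rw [act_apply, act_apply, act_apply]
  refine congrArg χ.1.1 (SetLike.ext fun t => ?_)
  simp only [Hull.mem_preim, Hull.mul_apply, Option.bind_eq_some_iff]
  constructor
  · rintro ⟨r, h0, a, h1, h2⟩; exact ⟨a, ⟨r, h0, h2⟩, h1⟩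
  · rintro ⟨a, ⟨r, h0, h2⟩, h1⟩; exact ⟨r, h0, a, h1, h2⟩

theorem act_one (χ : Omega S) : act 1 χ χ.map_dom_one = χ := by
  ext X
  rw [act_apply]
  refine congrArg χ.1.1 (SetLike.ext fun t => ?_)
  simp [Hull.mem_preim, Hull.one_val]

instance : T2Space (Omega S) :=
  inferInstanceAs (T2Space {_χ : {_χ : CIdeal S → Bool // _} // _})

instance : CompactSpace (Omega S) := by
  have h1 : IsClosed {χ : CIdeal S → Bool |
      (∀ X Y, χ (X ⊓ Y) = (χ X && χ Y)) ∧ ∃ X, χ X = true} := by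
    have : {χ : CIdeal S → Bool | (∀ X Y, χ (X ⊓ Y) = (χ X && χ Y)) ∧ ∃ X, χ X = true} =
        (⋂ X, ⋂ Y, {χ | χ (X ⊓ Y) = (χ X && χ Y)}) ∩ {χ | χ (1 : Hull S).dom = true} := by
      ext χ
      simp only [mem_ofPred_eq, mem_inter_iff, mem_iInter]
      refine and_congr_right fun h => ⟨fun ⟨X, hX⟩ => ?_, fun h => ⟨_, h⟩⟩
      have : X ⊓ (1 : Hull S).dom = X :=
        SetLike.ext fun t => (CIdeal.mem_inf _ _ t).trans
          ⟨fun H => H.1, fun H => ⟨H, by simp [Hull.mem_dom, Hull.one_val]⟩⟩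
      rw [← this, h, Bool.and_eq_true] at hX; exact hX.2
    rw [this]
    refine IsClosed.inter (isClosed_iInter fun X => isClosed_iInter fun Y => ?_) ?_
    · refine isClosed_eq (_root_.continuous_apply _) ?_
      have hc : Continuous fun p : Bool × Bool => p.1 && p.2 := continuous_of_discreteTopology
      have hp : Continuous fun χ : CIdeal S → Bool => (χ X, χ Y) :=
        (_root_.continuous_apply X).prodMk (_root_.continuous_apply Y)
      exact hc.comp hp
    · exact isClosed_eq (_root_.continuous_apply _) continuous_const
  have : CompactSpace (SemiChar S) := isCompact_iff_compactSpace.1 h1.isCompact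
  exact isCompact_iff_compactSpace.1 (isClosed_closure.isCompact)

end Omega
/-! ### Groupoids of germs over `Ω(S)` -/

/-- An auxiliary notion used to treat the two groupoids at once: for every `χ ∈ Ω(S)` a family of
subsets of `S` ("neighbourhoods of `χ`") on which two elements of `I_ℓ(S)` have to agree in order
to define the same germ at `χ`. -/
structure GermSystem (S : Type*) [LeftCancelMonoid S] where
  nhd : Omega S → Set (Set S)
  of_mem : ∀ (χ : Omega S) (X : CIdeal S), χ X = true → {t | t ∈ X} ∈ nhd χ
  inter : ∀ χ A B, A ∈ nhd χ → B ∈ nhd χ → A ∩ B ∈ nhd χ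
  preimage : ∀ (g : Hull S) χ h A, A ∈ nhd (Omega.act g χ h) → g.preimage A ∈ nhd χ
  isOpen : ∀ A, IsOpen {χ | A ∈ nhd χ}
  separates : ∀ (χ : Omega S) A (X Y : CIdeal S), A ∈ nhd χ →
    (∀ t ∈ A, t ∈ X ↔ t ∈ Y) → (χ X = true ↔ χ Y = true)
  mem_of_pt : ∀ s A, A ∈ nhd (Omega.pt s) → s ∈ A

variable (S) in
/-- The constructible ideals `X` with `χ(p_X) = 1`. -/
def idealSystem : GermSystem S where
  nhd χ := {A | ∃ X : CIdeal S, A = {t | t ∈ X} ∧ χ X = true}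
  of_mem _ X h := ⟨X, rfl, h⟩
  inter := by
    rintro χ _ _ ⟨X, rfl, hX⟩ ⟨Y, rfl, hY⟩
    exact ⟨X ⊓ Y, rfl, (χ.map_inf X Y).2 ⟨hX, hY⟩⟩
  preimage := by
    rintro g χ h _ ⟨X, rfl, hX⟩
    exact ⟨g.preim X, rfl, hX⟩
  isOpen A := by
    have : {χ : Omega S | A ∈ {A | ∃ X : CIdeal S, A = {t | t ∈ X} ∧ χ X = true}} =
        ⋃ X : CIdeal S, {χ | A = {t | t ∈ X} ∧ χ X = true} := by ext; simp
    rw [this]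
    refine isOpen_iUnion fun X => ?_
    by_cases hA : A = {t | t ∈ X}
    · simpa [hA] using (Omega.isClopen_setOf X).isOpen
    · simp only [hA, false_and]; exact isOpen_const
  separates := by
    classical
    rintro χ _ X Y ⟨Z, rfl, hZ⟩ h
    obtain ⟨s, hs⟩ := χ.exists_pt {X, Y, Z}
    rw [hs X (by simp), hs Y (by simp)]
    exact h s ((hs Z (by simp)).1 hZ)
  mem_of_pt := by
    rintro s _ ⟨X, rfl, hX⟩
    exact (Omega.pt_apply s X).1 hX

/-- The set `X \ (X₁ ∪ … ∪ Xₘ)`. -/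
def diffSet (X : CIdeal S) (F : Finset (CIdeal S)) : Set S := {t | t ∈ X ∧ ∀ Y ∈ F, t ∉ Y}

/-- The extension of `χ ∈ Ω(S)` to the semilattice `𝒥̄(S)` of all sets `X \ (X₁ ∪ … ∪ Xₘ)` with
`X, X₁, …, Xₘ` constructible and `m ≥ 0`: the extension takes the value `1` at `A` if and only if
`A = X \ (X₁ ∪ … ∪ Xₘ)` with `χ(p_X) = 1` and `χ(p_{X_i}) = 0` for all `i`. -/
def Omega.extEqOne (χ : Omega S) (A : Set S) : Prop :=
  ∃ (X : CIdeal S) (F : Finset (CIdeal S)), A = diffSet X F ∧ χ X = true ∧ ∀ Y ∈ F, χ Y = false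

variable (S) in
/-- The sets `A ∈ 𝒥̄(S)` with `χ(p_A) = 1`. -/
def diffSystem : GermSystem S where
  nhd χ := {A | χ.extEqOne A}
  of_mem _ X h := ⟨X, ∅, by simp [diffSet], h, by simp⟩
  inter := by
    classical
    rintro χ _ _ ⟨X, F, rfl, hX, hF⟩ ⟨Y, G, rfl, hY, hG⟩
    refine ⟨X ⊓ Y, F ∪ G, ?_, (χ.map_inf X Y).2 ⟨hX, hY⟩, ?_⟩
    · ext t
      simp only [diffSet, mem_inter_iff, mem_ofPred_eq, CIdeal.mem_inf, Finset.mem_union]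
      grind
    · intro Z hZ
      exact (Finset.mem_union.1 hZ).elim (hF Z) (hG Z)
  preimage := by
    classical
    rintro g χ h _ ⟨X, F, rfl, hX, hF⟩
    refine ⟨g.preim X, F.image g.preim, ?_, hX, ?_⟩
    · ext t
      simp only [diffSet, Hull.preimage, mem_ofPred_eq, Hull.mem_preim, Finset.mem_image,
        forall_exists_index, and_imp, forall_apply_eq_imp_iff₂]
      constructor
      · rintro ⟨r, ⟨h1, h2⟩, h3⟩
        refine ⟨⟨r, h1, h3⟩, ?_⟩
        rintro Y hY ⟨r', h4, h5⟩
        rw [h3] at h5; cases h5; exact h2 Y hY h4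
      · rintro ⟨⟨r, h1, h3⟩, h2⟩
        exact ⟨r, ⟨h1, fun Y hY hr => h2 Y hY ⟨r, hr, h3⟩⟩, h3⟩
    · intro Z hZ
      obtain ⟨Y, hY, rfl⟩ := Finset.mem_image.1 hZ
      exact hF Y hY
  isOpen A := by
    have : {χ : Omega S | A ∈ {A | χ.extEqOne A}} = ⋃ (X : CIdeal S) (F : Finset (CIdeal S)),
        {χ | A = diffSet X F} ∩ ({χ | χ X = true} ∩ ⋂ Y ∈ F, {χ | χ Y = true}ᶜ) := by
      ext χ
      simp [Omega.extEqOne]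
    rw [this]
    refine isOpen_iUnion fun X => isOpen_iUnion fun F => ?_
    refine isOpen_const.inter ((Omega.isClopen_setOf X).isOpen.inter ?_)
    exact isOpen_biInter_finset fun Y _ => (Omega.isClopen_setOf Y).compl.isOpen
  separates := by
    classical
    rintro χ _ X Y ⟨Z, F, rfl, hZ, hF⟩ h
    obtain ⟨s, hs⟩ := χ.exists_pt (insert X (insert Y (insert Z F)))
    rw [hs X (by simp), hs Y (by simp)]
    refine h s ⟨(hs Z (by simp)).1 hZ, fun W hW hsW => ?_⟩
    have := (hs W (by simp [hW])).2 hsW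
    rw [hF W hW] at this; cases this
  mem_of_pt := by
    rintro s _ ⟨X, F, rfl, hX, hF⟩
    refine ⟨(Omega.pt_apply s X).1 hX, fun Y hY hs => ?_⟩
    have := (Omega.pt_apply s Y).2 hs
    rw [hF Y hY] at this; cases this

variable (S) in
/-- The set `Σ` of pairs `(g, χ)`, `g ∈ I_ℓ(S)`, `χ ∈ Ω(S)`, with `χ(g⁻¹ g) = 1`. -/
def PreGerm : Type _ := {p : Hull S × Omega S // p.2 p.1.dom = true}

namespace GermSystem

variable (N : GermSystem S)

/-- `(g, χ)` and `(h, ψ)` are equivalent if `χ = ψ` and `g|_A = h|_A` for some neighbourhood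
`A` of `χ`. -/
def rel (p q : PreGerm S) : Prop :=
  p.1.2 = q.1.2 ∧ ∃ A ∈ N.nhd p.1.2, ∀ t ∈ A, p.1.1.1 t = q.1.1.1 t

/-- The equivalence relation defining germs. -/
def setoid : Setoid (PreGerm S) where
  r := N.rel
  iseqv :=
    { refl := fun p => ⟨rfl, _, N.of_mem _ _ p.2, fun _ _ => rfl⟩
      symm := by
        rintro p q ⟨h, A, hA, H⟩
        exact ⟨h.symm, A, h ▸ hA, fun t ht => (H t ht).symm⟩
      trans := by
        rintro p q r ⟨h, A, hA, H⟩ ⟨h', B, hB, H'⟩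
        refine ⟨h.trans h', A ∩ B, N.inter _ _ _ hA (h ▸ hB), fun t ht => ?_⟩
        exact (H t ht.1).trans (H' t ht.2) }

/-- The set of germs `[g, χ]`. -/
def Germ : Type _ := Quotient N.setoid

variable {N}

/-- The germ `[g, χ]`. -/
def germ (g : Hull S) (χ : Omega S) (h : χ g.dom = true) : N.Germ :=
  Quotient.mk N.setoid ⟨(g, χ), h⟩

theorem germ_eq_germ {g h : Hull S} {χ : Omega S} (hg : χ g.dom = true) (hh : χ h.dom = true) :
    (germ g χ hg : N.Germ) = germ h χ hh ↔ ∃ A ∈ N.nhd χ, ∀ t ∈ A, g.1 t = h.1 t := by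
  exact (Quotient.eq (r := N.setoid)).trans ⟨fun h => h.2, fun h => ⟨rfl, h⟩⟩

theorem germ_congr {g h : Hull S} {χ ψ : Omega S} (hg : χ g.dom = true) (e : g = h) (e' : χ = ψ) :
    (germ g χ hg : N.Germ) = germ h ψ (e ▸ e' ▸ hg) := by subst e e'; rfl

/-- The source `χ` of `[g, χ]`. -/
def src : N.Germ → Omega S := Quotient.lift (fun p => p.1.2) fun _ _ h => h.1

theorem act_eq {g h : Hull S} {χ : Omega S} (hg : χ g.dom = true) (hh : χ h.dom = true)
    {A : Set S} (hA : A ∈ N.nhd χ) (H : ∀ t ∈ A, g.1 t = h.1 t) :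
    Omega.act g χ hg = Omega.act h χ hh := by
  ext X
  rw [Bool.eq_iff_iff]
  exact N.separates χ A _ _ hA fun t ht => by simp only [Hull.mem_preim, H t ht]

/-- The range `χ(g⁻¹ · g)` of `[g, χ]`. -/
def rng : N.Germ → Omega S := Quotient.lift (fun p => Omega.act p.1.1 p.1.2 p.2) (by
  rintro ⟨⟨g, χ⟩, hg⟩ ⟨⟨h, ψ⟩, hh⟩ ⟨e, A, hA, H⟩
  dsimp only at e
  subst e
  exact act_eq hg hh hA H)

@[simp] theorem src_germ (g : Hull S) (χ h) : src (germ g χ h : N.Germ) = χ := rfl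

@[simp] theorem rng_germ (g : Hull S) (χ h) : rng (germ g χ h : N.Germ) = Omega.act g χ h := rfl

/-- Every germ is of the form `[g, χ]`. -/
theorem exists_germ (a : N.Germ) : ∃ g χ h, a = germ g χ h := by
  induction a using Quotient.ind with | _ p => exact ⟨p.1.1, p.1.2, p.2, rfl⟩

/-- The unit `[p_S, χ]` at `χ`. -/
noncomputable def one (χ : Omega S) : N.Germ := germ 1 χ χ.map_dom_one

/-- The inverse `[g⁻¹, χ(g⁻¹ · g)]` of `[g, χ]`. -/
def inv : N.Germ → N.Germ :=
  Quotient.lift (fun p => germ p.1.1⁻¹ (Omega.act p.1.1 p.1.2 p.2) (Omega.dom_inv_act _ _ _)) (by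
    rintro ⟨⟨g, χ⟩, hg⟩ ⟨⟨h, ψ⟩, hh⟩ ⟨e, A, hA, H⟩
    dsimp only at e hA H ⊢
    subst e
    have hact := act_eq hg hh hA H
    rw [germ_congr (Omega.dom_inv_act h χ hh) rfl hact.symm, germ_eq_germ]
    refine ⟨g⁻¹.preimage A, N.preimage _ _ (Omega.dom_inv_act g χ hg) _ ?_, ?_⟩
    · rw [Omega.act_inv_act]; exact hA
    · rintro r ⟨t, ht, hr⟩
      rw [hr, eq_comm, Hull.inv_eq_some, ← H t ht, ← Hull.inv_eq_some, hr])

theorem inv_germ (g : Hull S) (χ h) :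
    inv (germ g χ h : N.Germ) = germ g⁻¹ (Omega.act g χ h) (Omega.dom_inv_act _ _ _) := rfl

theorem dom_mul {g h : Hull S} {χ : Omega S} (hh : χ h.dom = true)
    (hg : Omega.act h χ hh g.dom = true) : χ (g * h).dom = true := by
  rw [Omega.mul_dom]; exact hg

theorem mul_congr {g g' h h' : Hull S} {χ : Omega S} (hh : χ h.dom = true)
    (hg : Omega.act h χ hh g.dom = true) (hh' : χ h'.dom = true)
    (hg' : Omega.act h' χ hh' g'.dom = true)
    (e : (germ h χ hh : N.Germ) = germ h' χ hh')
    (e' : (germ g _ hg : N.Germ) = germ g' _ hg') :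
    (germ (g * h) χ (dom_mul hh hg) : N.Germ) = germ (g' * h') χ (dom_mul hh' hg') := by
  obtain ⟨A, hA, H⟩ := (germ_eq_germ _ _).1 e
  have hact := act_eq hh hh' hA H
  rw [germ_congr hg' rfl hact.symm, germ_eq_germ] at e'
  obtain ⟨B, hB, H'⟩ := e'
  rw [germ_eq_germ]
  refine ⟨A ∩ h.preimage B, N.inter _ _ _ hA (N.preimage _ _ hh _ hB), ?_⟩
  rintro t ⟨ht, r, hr, htr⟩
  rw [Hull.mul_apply, Hull.mul_apply, ← H t ht, htr]
  exact H' r hr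

/-- The product `[g, χ] [h, ψ] = [g h, ψ]`, defined if `χ = ψ(h⁻¹ · h)`. -/
noncomputable def mul (a b : N.Germ) (H : src a = rng b) : N.Germ :=
  germ ((exists_germ a).choose * (exists_germ b).choose) (src b) (by
    obtain ⟨χ, h, e⟩ := (exists_germ a).choose_spec
    obtain ⟨ψ, k, f⟩ := (exists_germ b).choose_spec
    have hb := congrArg src f
    rw [src_germ] at hb
    subst hb
    refine dom_mul k ?_
    have h1 := congrArg src e
    have h2 := congrArg rng f
    rw [src_germ] at h1
    rw [rng_germ] at h2
    rw [← h2, ← H, h1]; exact h)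

theorem mul_germ (g h : Hull S) (χ : Omega S) (hh : χ h.dom = true)
    (hg : Omega.act h χ hh g.dom = true) (H) :
    mul (germ g _ hg) (germ h χ hh : N.Germ) H = germ (g * h) χ (dom_mul hh hg) := by
  have ea := (exists_germ (germ g _ hg : N.Germ)).choose_spec
  have eb := (exists_germ (germ h χ hh : N.Germ)).choose_spec
  obtain ⟨χ', h1, e1⟩ := ea
  obtain ⟨ψ, h2, e2⟩ := eb
  have f1 : Omega.act h χ hh = χ' := congrArg src e1
  have f2 : χ = ψ := congrArg src e2
  subst f1 f2
  have f3 := congrArg rng e2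
  rw [rng_germ, rng_germ] at f3
  exact (mul_congr hh hg h2 (f3 ▸ h1) e2 (e1.trans (germ_congr h1 rfl f3))).symm

/-! #### Topology -/

/-- The set `D(g, U)` of germs `[g, χ]` with `χ ∈ U`. -/
def basicSet (N : GermSystem S) (g : Hull S) (U : Set (Omega S)) : Set N.Germ :=
  {a | ∃ χ ∈ U, ∃ h, a = germ g χ h}

/-- The topology with the sets `D(g, U)`, for `U` open, as a basis
(see `isTopologicalBasis_basicSet`). -/
instance : TopologicalSpace N.Germ :=
  TopologicalSpace.generateFrom {D | ∃ g U, IsOpen U ∧ D = basicSet N g U}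

theorem isOpen_basicSet (g : Hull S) {U : Set (Omega S)} (hU : IsOpen U) :
    IsOpen (basicSet N g U) := TopologicalSpace.isOpen_generateFrom_of_mem ⟨g, U, hU, rfl⟩

/-- The section `χ ↦ [g, χ]`. -/
def sect (N : GermSystem S) (g : Hull S) (χ : {χ : Omega S // χ g.dom = true}) : N.Germ :=
  germ g χ.1 χ.2

theorem continuous_sect (g : Hull S) : Continuous (sect N g) := by
  refine continuous_generateFrom_iff.2 ?_
  rintro _ ⟨h, U, hU, rfl⟩
  have : sect N g ⁻¹' basicSet N h U = Subtype.val ⁻¹' (U ∩ {χ | χ h.dom = true} ∩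
      ⋃ (A : {A : Set S // ∀ t ∈ A, g.1 t = h.1 t}), {χ | A.1 ∈ N.nhd χ}) := by
    ext ⟨χ, hχ⟩
    simp only [mem_preimage, basicSet, mem_ofPred_eq, sect, mem_inter_iff, mem_iUnion,
      Subtype.exists]
    constructor
    · rintro ⟨ψ, hψ, hh, e⟩
      obtain rfl : χ = ψ := congrArg src e
      obtain ⟨A, hA, H⟩ := (germ_eq_germ _ _).1 e
      exact ⟨⟨hψ, hh⟩, A, H, hA⟩
    · rintro ⟨⟨h1, h2⟩, A, H, hA⟩
      exact ⟨χ, h1, h2, (germ_eq_germ _ _).2 ⟨A, hA, H⟩⟩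
  rw [this]
  refine IsOpen.preimage continuous_subtype_val ?_
  exact (hU.inter (Omega.isClopen_setOf _).isOpen).inter (isOpen_iUnion fun A => N.isOpen A.1)

theorem isOpen_iff {V : Set N.Germ} :
    IsOpen V ↔ ∀ g : Hull S, IsOpen {χ : Omega S | ∃ h, germ g χ h ∈ V} := by
  constructor
  · intro hV g
    have : {χ : Omega S | ∃ h, germ g χ h ∈ V} = Subtype.val '' (sect N g ⁻¹' V) := by
      ext χ; simp [sect]
    rw [this]
    exact (Omega.isClopen_setOf g.dom).isOpen.isOpenMap_subtype_val _
      (hV.preimage (continuous_sect g))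
  · intro h
    have : V = ⋃ g : Hull S, basicSet N g {χ : Omega S | ∃ h, germ g χ h ∈ V} := by
      ext a
      obtain ⟨g, χ, hg, rfl⟩ := exists_germ a
      simp only [mem_iUnion, basicSet, mem_ofPred_eq]
      constructor
      · intro ha; exact ⟨g, χ, ⟨hg, ha⟩, hg, rfl⟩
      · rintro ⟨g', ψ, ⟨h1, h2⟩, h3, e⟩; rw [e]; exact h2
    rw [this]
    exact isOpen_iUnion fun g => isOpen_basicSet g (h g)

theorem isTopologicalBasis_basicSet : TopologicalSpace.IsTopologicalBasis
    {D : Set N.Germ | ∃ g U, IsOpen U ∧ D = basicSet N g U} := by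
  refine TopologicalSpace.isTopologicalBasis_of_isOpen_of_nhds ?_ ?_
  · rintro _ ⟨g, U, hU, rfl⟩; exact isOpen_basicSet g hU
  · intro a V ha hV
    obtain ⟨g, χ, hg, rfl⟩ := exists_germ a
    refine ⟨_, ⟨g, _, isOpen_iff.1 hV g, rfl⟩, ⟨χ, ⟨hg, ha⟩, hg, rfl⟩, ?_⟩
    rintro _ ⟨ψ, ⟨h1, h2⟩, h3, rfl⟩
    exact h2

theorem continuous_src : Continuous (src (N := N)) := by
  refine continuous_def.2 fun U hU => isOpen_iff.2 fun g => ?_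
  have : {χ : Omega S | ∃ h, germ g χ h ∈ src (N := N) ⁻¹' U} = U ∩ {χ | χ g.dom = true} := by
    ext χ; simp [and_comm]
  rw [this]
  exact hU.inter (Omega.isClopen_setOf _).isOpen

theorem isOpenMap_src : IsOpenMap (src (N := N)) := by
  intro V hV
  have : src '' V = ⋃ g : Hull S, {χ : Omega S | ∃ h, germ g χ h ∈ V} := by
    ext χ
    simp only [mem_image, mem_iUnion, mem_ofPred_eq]
    constructor
    · rintro ⟨a, ha, rfl⟩
      obtain ⟨g, χ, hg, rfl⟩ := exists_germ a
      exact ⟨g, hg, ha⟩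
    · rintro ⟨g, hg, ha⟩; exact ⟨_, ha, rfl⟩
  rw [this]
  exact isOpen_iUnion fun g => isOpen_iff.1 hV g

theorem isLocalHomeomorph_src : IsLocalHomeomorph (src (N := N)) := by
  rw [isLocalHomeomorph_iff_isOpenEmbedding_restrict]
  intro a
  obtain ⟨g, χ, hg, rfl⟩ := exists_germ a
  have hD : IsOpen (basicSet N g univ) := isOpen_basicSet g isOpen_univ
  refine ⟨basicSet N g univ, hD.mem_nhds ⟨χ, trivial, hg, rfl⟩, ?_⟩
  refine Topology.IsOpenEmbedding.of_continuous_injective_isOpenMap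
    (continuous_src.comp continuous_subtype_val) ?_ (isOpenMap_src.comp hD.isOpenMap_subtype_val)
  rintro ⟨_, ψ, -, h, rfl⟩ ⟨_, ψ', -, h', rfl⟩ (e : ψ = ψ')
  subst e
  rfl

theorem inv_inv (a : N.Germ) : inv (inv a) = a := by
  obtain ⟨g, χ, hg, rfl⟩ := exists_germ a
  rw [inv_germ, inv_germ]
  exact germ_congr _ rfl (Omega.act_inv_act g χ hg)

theorem src_inv (a : N.Germ) : src (inv a) = rng a := by
  obtain ⟨g, χ, hg, rfl⟩ := exists_germ a
  rfl

theorem rng_inv (a : N.Germ) : rng (inv a) = src a := by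
  rw [← src_inv, inv_inv]

theorem continuous_act (g : Hull S) :
    Continuous fun χ : {χ : Omega S // χ g.dom = true} => Omega.act g χ.1 χ.2 := by
  refine Continuous.subtype_mk (Continuous.subtype_mk ?_ _) _
  refine continuous_pi fun X => ?_
  exact (Omega.continuous_apply (g.preim X)).comp continuous_subtype_val

theorem continuous_of_sect {Y : Type*} [TopologicalSpace Y] {f : N.Germ → Y}
    (h : ∀ g, Continuous fun χ => f (sect N g χ)) : Continuous f := by
  refine continuous_def.2 fun U hU => isOpen_iff.2 fun g => ?_
  have : {χ : Omega S | ∃ h, germ g χ h ∈ f ⁻¹' U} =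
      Subtype.val '' ((fun χ => f (sect N g χ)) ⁻¹' U) := by
    ext χ; simp [sect]
  rw [this]
  exact (Omega.isClopen_setOf g.dom).isOpen.isOpenMap_subtype_val _ (hU.preimage (h g))

theorem continuous_inv : Continuous (inv (N := N)) := by
  refine continuous_of_sect fun g => ?_
  exact (continuous_sect g⁻¹).comp
    (Continuous.subtype_mk (continuous_act g) fun χ => Omega.dom_inv_act g χ.1 χ.2)

theorem isLocalHomeomorph_rng : IsLocalHomeomorph (rng (N := N)) := by
  let e : N.Germ ≃ₜ N.Germ :=
    { toFun := inv
      invFun := inv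
      left_inv := inv_inv
      right_inv := inv_inv
      continuous_toFun := continuous_inv
      continuous_invFun := continuous_inv }
  have : rng (N := N) = src ∘ e := funext fun a => (src_inv a).symm
  rw [this]
  exact isLocalHomeomorph_src.comp e.isLocalHomeomorph

theorem continuous_one : Continuous (one (N := N)) :=
  (continuous_sect 1).comp (Continuous.subtype_mk continuous_id fun χ => χ.map_dom_one)

theorem continuous_mul : Continuous
    fun p : {p : N.Germ × N.Germ // src p.1 = rng p.2} => mul p.1.1 p.1.2 p.2 := by
  rw [continuous_iff_continuousAt]
  rintro ⟨⟨a, b⟩, hab⟩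
  obtain ⟨g, χ', hg', rfl⟩ := exists_germ a
  obtain ⟨h, χ, hh, rfl⟩ := exists_germ b
  obtain rfl : χ' = Omega.act h χ hh := hab
  let W : Set {p : N.Germ × N.Germ // src p.1 = rng p.2} :=
    {p | p.1.1 ∈ basicSet N g univ ∧ p.1.2 ∈ basicSet N h univ}
  have hW : IsOpen W :=
    ((isOpen_basicSet g isOpen_univ).preimage (continuous_fst.comp continuous_subtype_val)).inter
      ((isOpen_basicSet h isOpen_univ).preimage (continuous_snd.comp continuous_subtype_val))
  have hmem : ∀ p ∈ W, (src p.1.2) (g * h).dom = true ∧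
      ∀ k, mul p.1.1 p.1.2 p.2 = germ (g * h) (src p.1.2) k := by
    rintro ⟨⟨_, _⟩, H⟩ ⟨⟨ψ', -, k', rfl⟩, ψ, -, k, rfl⟩
    obtain rfl : ψ' = Omega.act h ψ k := H
    exact ⟨dom_mul k k', fun _ => mul_germ _ _ _ _ _ _⟩
  refine ContinuousOn.continuousAt (s := W) ?_
    (hW.mem_nhds ⟨⟨_, trivial, hg', rfl⟩, _, trivial, hh, rfl⟩)
  rw [continuousOn_iff_continuous_domRestrict]
  have : W.domRestrict (fun p => mul p.1.1 p.1.2 p.2) =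
      sect N (g * h) ∘ fun p => ⟨src p.1.1.2, (hmem p.1 p.2).1⟩ :=
    funext fun p => (hmem p.1 p.2).2 _
  rw [this]
  refine (continuous_sect _).comp (Continuous.subtype_mk ?_ _)
  exact continuous_src.comp
    (continuous_snd.comp (continuous_subtype_val.comp continuous_subtype_val))

/-! #### The groupoid -/

theorem one_mul (a : N.Germ) : mul (one (rng a)) a rfl = a := by
  obtain ⟨g, χ, hg, rfl⟩ := exists_germ a
  refine (mul_germ 1 g χ hg (Omega.map_dom_one _) _).trans (germ_congr _ ?_ rfl)
  ext t
  rw [Hull.mul_apply, Hull.one_val]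
  cases g.1 t <;> rfl

theorem rng_one (χ : Omega S) : rng (one χ : N.Germ) = χ := Omega.act_one χ

theorem mul_one (a : N.Germ) : mul a (one (src a)) (rng_one _).symm = a := by
  obtain ⟨g, χ, hg, rfl⟩ := exists_germ a
  have hg' : Omega.act 1 χ χ.map_dom_one g.dom = true := by rw [Omega.act_one]; exact hg
  have e : (germ g χ hg : N.Germ) = germ g _ hg' := germ_congr _ rfl (Omega.act_one χ).symm
  have h1 := mul_germ (N := N) g 1 χ χ.map_dom_one hg' rfl
  have h2 : mul (germ g χ hg) (one χ) (rng_one _).symm =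
      mul (germ g _ hg') (germ 1 χ χ.map_dom_one : N.Germ) rfl := by congr 1
  refine (h2.trans h1).trans (germ_congr _ ?_ rfl)
  ext t
  rw [Hull.mul_apply, Hull.one_val]
  rfl

theorem mul_congr' {a a' b b' : N.Germ} (e : a = a') (e' : b = b') (H : src a = rng b) :
    mul a b H = mul a' b' (by rw [← e, ← e', H]) := by subst e e'; rfl

theorem inv_mul (a : N.Germ) : mul (inv a) a (src_inv a) = one (src a) := by
  obtain ⟨g, χ, hg, rfl⟩ := exists_germ a
  refine (mul_germ g⁻¹ g χ hg (Omega.dom_inv_act g χ hg) rfl).trans ?_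
  refine (germ_eq_germ _ _).2 ⟨_, N.of_mem χ g.dom hg, ?_⟩
  rintro t ⟨r, hr⟩
  rw [Hull.mul_apply, hr, Hull.one_val]
  exact (Hull.inv_eq_some g).2 hr

theorem mul_inv (a : N.Germ) : mul a (inv a) (rng_inv a).symm = one (rng a) := by
  have h := inv_mul (inv a)
  rw [src_inv] at h
  rw [← h]
  exact mul_congr' (inv_inv a).symm rfl _

theorem src_mul (a b : N.Germ) (H : src a = rng b) : src (mul a b H) = src b := rfl

theorem rng_mul (a b : N.Germ) (H : src a = rng b) : rng (mul a b H) = rng a := by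
  obtain ⟨g, χ', hg, rfl⟩ := exists_germ a
  obtain ⟨h, χ, hh, rfl⟩ := exists_germ b
  obtain rfl : χ' = Omega.act h χ hh := H
  exact (congrArg rng (mul_germ g h χ hh hg rfl)).trans (Omega.act_mul g h χ hh hg)

theorem mul_assoc (a b c : N.Germ) (H : src a = rng b) (K : src b = rng c) :
    mul (mul a b H) c K = mul a (mul b c K) (H.trans (rng_mul b c K).symm) := by
  obtain ⟨g, χ₁, hg, rfl⟩ := exists_germ a
  obtain ⟨h, χ₂, hh, rfl⟩ := exists_germ b
  obtain ⟨k, χ, hk, rfl⟩ := exists_germ c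
  obtain rfl : χ₂ = Omega.act k χ hk := K
  obtain rfl : χ₁ = Omega.act h _ hh := H
  have hg' : Omega.act (h * k) χ (dom_mul hk hh) g.dom = true := by
    rw [Omega.act_mul _ _ _ hk hh]; exact hg
  have e1 := mul_germ (N := N) g h _ hh hg rfl
  have e2 := mul_germ (N := N) h k _ hk hh rfl
  have e3 : (germ g _ hg : N.Germ) = germ g _ hg' := germ_congr _ rfl (Omega.act_mul _ _ _ hk hh).symm
  have e4 := mul_germ (N := N) (g * h) k _ hk (dom_mul hh hg) rfl
  have e5 := mul_germ (N := N) g (h * k) _ (dom_mul hk hh) hg' rfl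
  exact ((mul_congr' e1 rfl _).trans e4).trans ((germ_congr _ (Hull.mul_assoc' g h k) rfl).trans
    ((mul_congr' e3 e2 _).trans e5).symm)

end GermSystem

/-- The étale groupoid of germs `[g, χ]`, with unit space `Ω(S)`. -/
noncomputable def GermSystem.groupoid (N : GermSystem S) :
    EtaleGroupoid N.Germ (Omega S) where
  src := GermSystem.src
  rng := GermSystem.rng
  one := GermSystem.one
  inv := GermSystem.inv
  mul := GermSystem.mul
  src_one _ := rfl
  rng_one := GermSystem.rng_one
  src_inv := GermSystem.src_inv
  rng_inv := GermSystem.rng_inv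
  src_mul := GermSystem.src_mul
  rng_mul := GermSystem.rng_mul
  mul_assoc := GermSystem.mul_assoc
  one_mul := GermSystem.one_mul
  mul_one := GermSystem.mul_one
  inv_mul := GermSystem.inv_mul
  mul_inv := GermSystem.mul_inv
  t2Space := inferInstance
  locallyCompactSpace := inferInstance
  isLocalHomeomorph_src := GermSystem.isLocalHomeomorph_src
  isLocalHomeomorph_rng := GermSystem.isLocalHomeomorph_rng
  continuous_one := GermSystem.continuous_one
  continuous_inv := GermSystem.continuous_inv
  continuous_mul := GermSystem.continuous_mul

variable (S) in
/-- The groupoid `𝒢_P(S)`: the reduction to `Ω(S)` of the Paterson groupoid of `I_ℓ(S)`.  Here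
`[g, χ] = [h, χ]` if and only if `g p_X = h p_X` for a constructible ideal `X` with
`χ(p_X) = 1`. -/
noncomputable def groupoidP : EtaleGroupoid (idealSystem S).Germ (Omega S) :=
  (idealSystem S).groupoid

variable (S) in
/-- The groupoid `𝒢(S)`: the quotient of `𝒢_P(S)` in which `[g, χ] = [h, χ]` if and only if
`g|_A = h|_A` for a set `A ∈ 𝒥̄(S)` with `χ(p_A) = 1`. -/
noncomputable def groupoidQ : EtaleGroupoid (diffSystem S).Germ (Omega S) :=
  (diffSystem S).groupoid

end LCMonoid

/-! ### Hilbert spaces `ℓ²(ι)` -/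

/-- The Hilbert space `ℓ²(ι)`. -/
abbrev Ell2 (ι : Type*) : Type _ := lp (fun _ : ι => ℂ) 2

/-- The standard orthonormal basis vector `δ_i`. -/
noncomputable def delta {ι : Type*} (i : ι) : Ell2 ι := open Classical in lp.single 2 i 1

theorem delta_apply_self {ι : Type*} (i : ι) : delta i i = 1 := by
  classical
  simp [delta]

theorem delta_apply_ne {ι : Type*} {i j : ι} (h : j ≠ i) : delta i j = 0 := by
  classical
  simp [delta, lp.single_apply, h]

theorem inner_delta {ι : Type*} (i : ι) (ξ : Ell2 ι) : inner ℂ (delta i) ξ = ξ i := by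
  classical
  simp [delta, lp.inner_single_left]

theorem orthonormal_delta {ι κ : Type*} (φ : ι → κ) (hφ : Function.Injective φ) :
    Orthonormal ℂ fun i => delta (φ i) := by
  classical
  rw [orthonormal_iff_ite]
  intro i j
  rw [inner_delta]
  split_ifs with h
  · rw [h, delta_apply_self]
  · exact delta_apply_ne fun h' => h (hφ h')

/-- The isometry `ℓ²(ι) → ℓ²(κ)`, `δ_i ↦ δ_{φ i}`, defined by an injective map `φ`. -/
noncomputable def ell2Map {ι κ : Type*} (φ : ι → κ) (hφ : Function.Injective φ) :
    Ell2 ι →ₗᵢ[ℂ] Ell2 κ :=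
  (orthonormal_delta φ hφ).orthogonalFamily.linearIsometry

theorem ell2Map_delta {ι κ : Type*} (φ : ι → κ) (hφ : Function.Injective φ) (i : ι) :
    ell2Map φ hφ (delta i) = delta (φ i) := by
  classical
  unfold ell2Map
  rw [delta, OrthogonalFamily.linearIsometry_apply_single]
  simp

/-- The unitary `ℓ²(ι) → ℓ²(κ)` defined by a bijection `ι → κ`. -/
noncomputable def ell2Congr {ι κ : Type*} (e : ι ≃ κ) : Ell2 ι ≃ₗᵢ[ℂ] Ell2 κ where
  toFun ξ := ⟨fun k => ξ (e.symm k), memℓp_gen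
    ((e.symm.summable_iff (f := fun i => ‖ξ i‖ ^ (2 : ℝ≥0∞).toReal)).2
      ((lp.memℓp ξ).summable (by simp)))⟩
  invFun η := ⟨fun i => η (e i), memℓp_gen
    ((e.summable_iff (f := fun k => ‖η k‖ ^ (2 : ℝ≥0∞).toReal)).2
      ((lp.memℓp η).summable (by simp)))⟩
  left_inv ξ := by ext i; exact congrArg ξ (e.symm_apply_apply i)
  right_inv η := by ext i; exact congrArg η (e.apply_symm_apply i)
  map_add' ξ η := rfl
  map_smul' c ξ := rfl
  norm_map' ξ := by
    rw [lp.norm_eq_tsum_rpow (by simp), lp.norm_eq_tsum_rpow (by simp)]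
    congr 1
    exact e.symm.tsum_eq (fun i => ‖ξ i‖ ^ (2 : ℝ≥0∞).toReal)

theorem ell2Congr_apply {ι κ : Type*} (e : ι ≃ κ) (ξ : Ell2 ι) (k : κ) :
    ell2Congr e ξ k = ξ (e.symm k) := rfl

theorem ell2Congr_delta {ι κ : Type*} (e : ι ≃ κ) (i : ι) :
    ell2Congr e (delta i) = delta (e i) := by
  ext k
  rw [ell2Congr_apply]
  by_cases h : k = e i
  · subst h; rw [e.symm_apply_apply, delta_apply_self, delta_apply_self]
  · rw [delta_apply_ne h, delta_apply_ne]
    rintro rfl; exact h (e.apply_symm_apply k).symm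

/-! ### The reduced and the essential C*-algebras of an étale groupoid -/

namespace EtaleGroupoid

variable {G X : Type*} [TopologicalSpace G] [TopologicalSpace X] (𝒢 : EtaleGroupoid G X)

/-- An open bisection: an open set on which the source and the range maps are injective (and so,
being local homeomorphisms, they are homeomorphisms onto open subsets of the unit space). -/
def IsOpenBisection (U : Set G) : Prop := IsOpen U ∧ InjOn 𝒢.src U ∧ InjOn 𝒢.rng U

/-- The continuous compactly supported functions on an open bisection `U`, extended by zero. -/
def CcOn (U : Set G) : Set (G → ℂ) :=
  {f | ContinuousOn f U ∧ ∃ K, IsCompact K ∧ K ⊆ U ∧ ∀ g ∉ K, f g = 0}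

/-- The space `C_c(𝒢)`: the linear span of `C_c(U)` for all open bisections `U`. -/
def Cc : Submodule ℂ (G → ℂ) := Submodule.span ℂ (⋃ U ∈ {U | 𝒢.IsOpenBisection U}, CcOn U)

/-- The fibre `𝒢_x = s⁻¹(x)`. -/
def Fiber (x : X) : Type _ := {g : G // 𝒢.src g = x}

/-- The element `h⁻¹ g ∈ 𝒢_x`, for `g ∈ 𝒢_x` and `h` with the same range as `g`. -/
def Fiber.div {𝒢 : EtaleGroupoid G X} {x : X} (g : 𝒢.Fiber x)
    (h : {h : G // 𝒢.rng h = 𝒢.rng g.1}) : 𝒢.Fiber x :=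
  ⟨𝒢.mul (𝒢.inv h) g.1 ((𝒢.src_inv _).trans h.2), (𝒢.src_mul _ _ _).trans g.2⟩

/-- The function `g ↦ ∑_{h ∈ 𝒢^{r(g)}} f(h) ξ(h⁻¹ g)` on `𝒢_x`.  (For `f ∈ C_c(𝒢)` the sum has
only finitely many nonzero terms.) -/
noncomputable def conv (f : G → ℂ) {x : X} (ξ : 𝒢.Fiber x → ℂ) (g : 𝒢.Fiber x) : ℂ :=
  ∑ᶠ h : {h : G // 𝒢.rng h = 𝒢.rng g.1}, f h * ξ (g.div h)

/-- The product `g k ∈ 𝒢_x` for `g ∈ 𝒢_{r(k)}` and `k ∈ 𝒢_x`. -/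
def mulRight {x : X} (k : 𝒢.Fiber x) (g : 𝒢.Fiber (𝒢.rng k.1)) : 𝒢.Fiber x :=
  ⟨𝒢.mul g.1 k.1 g.2, (𝒢.src_mul _ _ _).trans k.2⟩

/-- The product `g k⁻¹ ∈ 𝒢_{r(k)}` for `g, k ∈ 𝒢_x`. -/
def divRight {x : X} (k : 𝒢.Fiber x) (g : 𝒢.Fiber x) : 𝒢.Fiber (𝒢.rng k.1) :=
  ⟨𝒢.mul g.1 (𝒢.inv k.1) ((g.2.trans k.2.symm).trans (𝒢.rng_inv _).symm),
    (𝒢.src_mul _ _ _).trans (𝒢.src_inv _)⟩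

variable {𝒢}

theorem mul_congr {g g' h h' : G} (e : g = g') (e' : h = h') (H : 𝒢.src g = 𝒢.rng h) :
    𝒢.mul g h H = 𝒢.mul g' h' (by rw [← e, ← e', H]) := by subst e e'; rfl

theorem mul_inv_cancel_right {g k : G} (H : 𝒢.src g = 𝒢.rng k) :
    𝒢.mul (𝒢.mul g k H) (𝒢.inv k) ((𝒢.src_mul _ _ _).trans (𝒢.rng_inv k).symm) = g := by
  rw [𝒢.mul_assoc g k _ H (𝒢.rng_inv k).symm, mul_congr rfl (𝒢.mul_inv k)]
  exact (mul_congr rfl (congrArg 𝒢.one H.symm) _).trans (𝒢.mul_one g)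

theorem inv_mul_cancel_right {g k : G} (H : 𝒢.src g = 𝒢.src k) :
    𝒢.mul (𝒢.mul g (𝒢.inv k) (H.trans (𝒢.rng_inv k).symm)) k
      ((𝒢.src_mul _ _ _).trans (𝒢.src_inv k)) = g := by
  rw [𝒢.mul_assoc g _ k (H.trans (𝒢.rng_inv k).symm) (𝒢.src_inv k), mul_congr rfl (𝒢.inv_mul k)]
  exact (mul_congr rfl (congrArg 𝒢.one H.symm) _).trans (𝒢.mul_one g)

theorem mul_inv_cancel_left {h g : G} (H : 𝒢.rng h = 𝒢.rng g) :
    𝒢.mul h (𝒢.mul (𝒢.inv h) g ((𝒢.src_inv h).trans H))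
      ((𝒢.rng_inv h).symm.trans (𝒢.rng_mul _ _ _).symm) = g := by
  rw [← 𝒢.mul_assoc h (𝒢.inv h) g (𝒢.rng_inv h).symm, mul_congr (𝒢.mul_inv h) rfl]
  exact (mul_congr (congrArg 𝒢.one H) rfl _).trans (𝒢.one_mul g)

/-- Right multiplication by `k`, as a bijection `𝒢_{r(k)} → 𝒢_x`. -/
def fiberEquiv {x : X} (k : 𝒢.Fiber x) : 𝒢.Fiber (𝒢.rng k.1) ≃ 𝒢.Fiber x where
  toFun := 𝒢.mulRight k
  invFun := 𝒢.divRight k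
  left_inv g := Subtype.ext (mul_inv_cancel_right g.2)
  right_inv g := Subtype.ext (inv_mul_cancel_right (g.2.trans k.2.symm))

theorem conv_congr (f : G → ℂ) {x : X} (k : 𝒢.Fiber x) (ξ : 𝒢.Fiber (𝒢.rng k.1) → ℂ)
    (g : 𝒢.Fiber x) :
    𝒢.conv f (fun g' => ξ (𝒢.divRight k g')) g = 𝒢.conv f ξ (𝒢.divRight k g) := by
  have hr : 𝒢.rng (𝒢.divRight k g).1 = 𝒢.rng g.1 := 𝒢.rng_mul _ _ _
  unfold conv
  rw [← finsum_comp_equiv (Equiv.subtypeEquivRight fun h => by rw [hr] :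
    {h : G // 𝒢.rng h = 𝒢.rng g.1} ≃ {h : G // 𝒢.rng h = 𝒢.rng (𝒢.divRight k g).1})]
  refine finsum_congr fun h => ?_
  exact congrArg (fun z => f h.1 * ξ z) (Subtype.ext (𝒢.mul_assoc _ _ _ _ _))

theorem div_eq_iff {x : X} (g k : 𝒢.Fiber x) (h : {h : G // 𝒢.rng h = 𝒢.rng g.1}) :
    g.div h = k ↔ h.1 = (𝒢.divRight k g).1 := by
  constructor
  · rintro rfl
    have h1 := mul_inv_cancel_left h.2
    have h2 : 𝒢.src h.1 = 𝒢.rng (g.div h).1 := (𝒢.rng_inv _).symm.trans (𝒢.rng_mul _ _ _).symm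
    exact (mul_inv_cancel_right h2).symm.trans (mul_congr h1 rfl _)
  · intro e
    have h2 : 𝒢.src h.1 = 𝒢.rng k.1 := by rw [e]; exact (𝒢.divRight k g).2
    have h3 : 𝒢.mul h.1 k.1 h2 = g.1 :=
      (mul_congr e rfl _).trans (inv_mul_cancel_right (g.2.trans k.2.symm))
    refine Subtype.ext ?_
    refine (mul_congr rfl h3.symm _).trans ?_
    rw [← 𝒢.mul_assoc _ _ _ (𝒢.src_inv _), mul_congr (𝒢.inv_mul h.1) rfl]
    exact (mul_congr (congrArg 𝒢.one h2) rfl _).trans (𝒢.one_mul _)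

theorem conv_delta (f : G → ℂ) {x : X} (k g : 𝒢.Fiber x) :
    𝒢.conv f (delta k) g = f (𝒢.divRight k g).1 := by
  have hr : 𝒢.rng (𝒢.divRight k g).1 = 𝒢.rng g.1 := 𝒢.rng_mul _ _ _
  unfold conv
  rw [finsum_eq_single _ ⟨(𝒢.divRight k g).1, hr⟩]
  · rw [(div_eq_iff g k ⟨_, hr⟩).2 rfl, delta_apply_self, _root_.mul_one]
  · intro h hne
    rw [delta_apply_ne, mul_zero]
    exact fun e => hne (Subtype.ext ((div_eq_iff g k h).1 e))

/-- Only finitely many values of `f` on each set `𝒢^y` are nonzero. -/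
def FinFib (𝒢 : EtaleGroupoid G X) (f : G → ℂ) : Prop :=
  ∀ y, {h : {h : G // 𝒢.rng h = y} | f h ≠ 0}.Finite

theorem FinFib.finite_support {f : G → ℂ} (hf : 𝒢.FinFib f) {x : X} (ξ : 𝒢.Fiber x → ℂ)
    (g : 𝒢.Fiber x) :
    (Function.support fun h : {h : G // 𝒢.rng h = 𝒢.rng g.1} => f h * ξ (g.div h)).Finite :=
  (hf _).subset fun _ hh => left_ne_zero_of_mul hh

theorem conv_add_left {f f' : G → ℂ} (hf : 𝒢.FinFib f) (hf' : 𝒢.FinFib f') {x : X}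
    (ξ : 𝒢.Fiber x → ℂ) (g : 𝒢.Fiber x) :
    𝒢.conv (f + f') ξ g = 𝒢.conv f ξ g + 𝒢.conv f' ξ g := by
  unfold conv
  rw [← finsum_add_distrib (hf.finite_support ξ g) (hf'.finite_support ξ g)]
  exact finsum_congr fun h => add_mul _ _ _

theorem conv_smul_left (f : G → ℂ) (c : ℂ) {x : X}
    (ξ : 𝒢.Fiber x → ℂ) (g : 𝒢.Fiber x) :
    𝒢.conv (c • f) ξ g = c * 𝒢.conv f ξ g := by
  unfold conv
  exact (finsum_congr fun h => _root_.mul_assoc _ _ _).trans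
    (mul_finsum _ c).symm

theorem conv_add_right {f : G → ℂ} (hf : 𝒢.FinFib f) {x : X}
    (ξ η : 𝒢.Fiber x → ℂ) (g : 𝒢.Fiber x) :
    𝒢.conv f (ξ + η) g = 𝒢.conv f ξ g + 𝒢.conv f η g := by
  unfold conv
  rw [← finsum_add_distrib (hf.finite_support ξ g) (hf.finite_support η g)]
  exact finsum_congr fun h => mul_add _ _ _

theorem conv_smul_right (f : G → ℂ) (c : ℂ) {x : X}
    (ξ : 𝒢.Fiber x → ℂ) (g : 𝒢.Fiber x) :
    𝒢.conv f (c • ξ) g = c * 𝒢.conv f ξ g := by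
  unfold conv
  exact (finsum_congr fun h => mul_left_comm _ _ _).trans
    (mul_finsum _ c).symm

theorem finFib_of_mem_CcOn {U : Set G} (hU : 𝒢.IsOpenBisection U) {f : G → ℂ} (hf : f ∈ CcOn U) :
    𝒢.FinFib f := by
  obtain ⟨-, K, -, hKU, hK⟩ := hf
  intro y
  refine Set.Subsingleton.finite ?_
  rintro ⟨h, hh⟩ h1 ⟨k, hk⟩ h2
  have a1 : h ∈ U := hKU (by_contra fun hn => h1 (hK _ hn))
  have a2 : k ∈ U := hKU (by_contra fun hn => h2 (hK _ hn))
  exact Subtype.ext (hU.2.2 a1 a2 (hh.trans hk.symm))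

theorem sum_conv_le {U : Set G} (hU : 𝒢.IsOpenBisection U) {f : G → ℂ} (hf : f ∈ CcOn U) {C : ℝ}
    (hC : ∀ g, ‖f g‖ ≤ C) {x : X} (ξ : Ell2 (𝒢.Fiber x)) (s : Finset (𝒢.Fiber x)) :
    ∑ g ∈ s, ‖𝒢.conv f ξ g‖ ^ (2 : ℝ≥0∞).toReal ≤ (C * ‖ξ‖) ^ (2 : ℝ≥0∞).toReal := by
  classical
  obtain ⟨-, K, -, hKU, hK⟩ := hf
  have hC0 : 0 ≤ C ∨ IsEmpty G := by
    by_cases h : Nonempty G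
    · exact .inl ((norm_nonneg _).trans (hC h.some))
    · exact .inr (not_nonempty_iff.1 h)
  rcases hC0 with hC0 | hG
  swap
  · have : IsEmpty (𝒢.Fiber x) := ⟨fun g => hG.false g.1⟩
    have hs : s = ∅ := Finset.eq_empty_of_isEmpty s
    rw [hs, lp.eq_zero' ξ]; simp
  have hval : ∀ (g : 𝒢.Fiber x) (h : {h : G // 𝒢.rng h = 𝒢.rng g.1}), h.1 ∈ U →
      𝒢.conv f ξ g = f h * ξ (g.div h) := by
    intro g h hh
    refine finsum_eq_single _ h fun k hne => ?_
    have : k.1 ∉ K := fun hk => hne (Subtype.ext (hU.2.2 (hKU hk) hh (k.2.trans h.2.symm)))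
    rw [hK _ this, zero_mul]
  have hval0 : ∀ g : 𝒢.Fiber x, (¬ ∃ h : {h : G // 𝒢.rng h = 𝒢.rng g.1}, h.1 ∈ U) →
      𝒢.conv f ξ g = 0 := by
    intro g hg
    refine finsum_eq_zero_of_forall_eq_zero fun k => ?_
    have : k.1 ∉ K := fun hk => hg ⟨k, hKU hk⟩
    rw [hK _ this, zero_mul]
  let A : 𝒢.Fiber x → Prop := fun g => ∃ h : {h : G // 𝒢.rng h = 𝒢.rng g.1}, h.1 ∈ U
  let φ : 𝒢.Fiber x → 𝒢.Fiber x := fun g => if h : A g then g.div h.choose else g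
  have hφ : ∀ g ∈ s.filter A, ∀ g' ∈ s.filter A, φ g = φ g' → g = g' := by
    intro g hg g' hg' e
    have ha := (Finset.mem_filter.1 hg).2
    have ha' := (Finset.mem_filter.1 hg').2
    simp only [φ, ha, ha', ↓reduceDIte] at e
    have e1 : 𝒢.src ha.choose.1 = 𝒢.src ha'.choose.1 := by
      have h2 : ∀ (g : 𝒢.Fiber x) h, 𝒢.rng (g.div h).1 = 𝒢.src h.1 := fun g h =>
        (𝒢.rng_mul _ _ _).trans (𝒢.rng_inv _)
      rw [← h2, ← h2, e]
    have e2 : ha.choose.1 = ha'.choose.1 := hU.2.1 ha.choose_spec ha'.choose_spec e1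
    refine Subtype.ext ?_
    rw [← mul_inv_cancel_left ha.choose.2, ← mul_inv_cancel_left ha'.choose.2]
    exact mul_congr e2 (congrArg Subtype.val e) _
  have h2 : (2 : ℝ≥0∞).toReal = 2 := by simp
  calc ∑ g ∈ s, ‖𝒢.conv f ξ g‖ ^ (2 : ℝ≥0∞).toReal
      = ∑ g ∈ s.filter A, ‖𝒢.conv f ξ g‖ ^ (2 : ℝ≥0∞).toReal := by
        rw [Finset.sum_filter_of_ne]
        intro g _ hne
        by_contra hA
        rw [hval0 g hA] at hne
        simp at hne
    _ ≤ ∑ g ∈ s.filter A, C ^ (2 : ℝ≥0∞).toReal * ‖ξ (φ g)‖ ^ (2 : ℝ≥0∞).toReal := by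
        refine Finset.sum_le_sum fun g hg => ?_
        have ha := (Finset.mem_filter.1 hg).2
        rw [← Real.mul_rpow hC0 (norm_nonneg _)]
        refine Real.rpow_le_rpow (norm_nonneg _) ?_ (by simp)
        rw [hval g _ ha.choose_spec, norm_mul]
        simp only [φ, ha, ↓reduceDIte]
        exact mul_le_mul_of_nonneg_right (hC _) (norm_nonneg _)
    _ = C ^ (2 : ℝ≥0∞).toReal * ∑ k ∈ (s.filter A).image φ, ‖ξ k‖ ^ (2 : ℝ≥0∞).toReal := by
        rw [← Finset.mul_sum, Finset.sum_image hφ]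
    _ ≤ C ^ (2 : ℝ≥0∞).toReal * ‖ξ‖ ^ (2 : ℝ≥0∞).toReal :=
        mul_le_mul_of_nonneg_left (lp.sum_rpow_le_norm_rpow (by simp) ξ _)
          (Real.rpow_nonneg hC0 _)
    _ = (C * ‖ξ‖) ^ (2 : ℝ≥0∞).toReal := (Real.mul_rpow hC0 (norm_nonneg _)).symm

theorem exists_rho_of_mem_CcOn {U : Set G} (hU : 𝒢.IsOpenBisection U) {f : G → ℂ}
    (hf : f ∈ CcOn U) : ∃ C : ℝ, 0 ≤ C ∧ ∀ x : X,
      ∃ T : Ell2 (𝒢.Fiber x) →L[ℂ] Ell2 (𝒢.Fiber x), ‖T‖ ≤ C ∧ ∀ ξ g, T ξ g = 𝒢.conv f ξ g := by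
  have hff := finFib_of_mem_CcOn hU hf
  obtain ⟨C, hC0, hC⟩ : ∃ C : ℝ, 0 ≤ C ∧ ∀ g, ‖f g‖ ≤ C := by
    obtain ⟨hc, K, hK, hKU, hK0⟩ := hf
    obtain ⟨C, hC⟩ := hK.exists_bound_of_continuousOn (hc.mono hKU)
    refine ⟨max C 0, le_max_right _ _, fun g => ?_⟩
    by_cases hg : g ∈ K
    · exact (hC g hg).trans (le_max_left _ _)
    · rw [hK0 g hg, norm_zero]; exact le_max_right _ _
  refine ⟨C, hC0, fun x => ?_⟩
  have hmem : ∀ ξ : Ell2 (𝒢.Fiber x), Memℓp (𝒢.conv f ξ) 2 :=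
    fun ξ => memℓp_gen' (sum_conv_le hU hf hC ξ)
  let T : Ell2 (𝒢.Fiber x) →ₗ[ℂ] Ell2 (𝒢.Fiber x) :=
    { toFun := fun ξ => ⟨𝒢.conv f ξ, hmem ξ⟩
      map_add' := fun ξ η => by ext g; exact conv_add_right hff _ _ g
      map_smul' := fun c ξ => by ext g; exact conv_smul_right _ c _ g }
  have hT : ∀ ξ, ‖T ξ‖ ≤ C * ‖ξ‖ := fun ξ =>
    lp.norm_le_of_forall_sum_le (by simp) (mul_nonneg hC0 (norm_nonneg _))
      (sum_conv_le hU hf hC ξ)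
  exact ⟨T.mkContinuous C hT, T.mkContinuous_norm_le hC0 hT, fun ξ g => rfl⟩

theorem exists_rho {f : G → ℂ} (hf : f ∈ 𝒢.Cc) : 𝒢.FinFib f ∧ ∃ C : ℝ, 0 ≤ C ∧ ∀ x : X,
      ∃ T : Ell2 (𝒢.Fiber x) →L[ℂ] Ell2 (𝒢.Fiber x), ‖T‖ ≤ C ∧ ∀ ξ g, T ξ g = 𝒢.conv f ξ g := by
  induction hf using Submodule.span_induction with
  | mem f hf =>
    simp only [mem_iUnion, mem_ofPred_eq, exists_prop] at hf
    obtain ⟨U, hU, hf⟩ := hf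
    exact ⟨finFib_of_mem_CcOn hU hf, exists_rho_of_mem_CcOn hU hf⟩
  | zero =>
    refine ⟨fun y => by simp, 0, le_rfl, fun x => ⟨0, by simp, fun ξ g => ?_⟩⟩
    simp [conv]
  | add f f' _ _ h h' =>
    obtain ⟨hf, C, hC, H⟩ := h
    obtain ⟨hf', C', hC', H'⟩ := h'
    refine ⟨fun y => ((hf y).union (hf' y)).subset fun h hh => ?_, C + C', add_nonneg hC hC',
      fun x => ?_⟩
    · by_contra hn
      simp only [mem_union, mem_ofPred_eq, not_or, not_not] at hn
      exact hh (by rw [Pi.add_apply, hn.1, hn.2, add_zero])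
    · obtain ⟨T, hT, hTf⟩ := H x
      obtain ⟨T', hT', hTf'⟩ := H' x
      refine ⟨T + T', (norm_add_le _ _).trans (add_le_add hT hT'), fun ξ g => ?_⟩
      rw [conv_add_left hf hf', ← hTf, ← hTf']; rfl
  | smul c f _ h =>
    obtain ⟨hf, C, hC, H⟩ := h
    refine ⟨fun y => (hf y).subset fun h hh => right_ne_zero_of_mul hh, ‖c‖ * C,
      mul_nonneg (norm_nonneg _) hC, fun x => ?_⟩
    obtain ⟨T, hT, hTf⟩ := H x
    refine ⟨c • T, (norm_smul_le _ _).trans (mul_le_mul_of_nonneg_left hT (norm_nonneg _)),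
      fun ξ g => ?_⟩
    rw [conv_smul_left _, ← hTf]; rfl

variable (𝒢)

/-- The operator `ρ_x(f)` on `ℓ²(𝒢_x)`, for `f ∈ C_c(𝒢)`; it is determined by `rho_apply`. -/
noncomputable def rho (x : X) (f : 𝒢.Cc) : Ell2 (𝒢.Fiber x) →L[ℂ] Ell2 (𝒢.Fiber x) :=
  ((exists_rho f.2).2.choose_spec.2 x).choose

/-- `(ρ_x(f) ξ)(g) = ∑_{h ∈ 𝒢^{r(g)}} f(h) ξ(h⁻¹ g)`. -/
theorem rho_apply (x : X) (f : 𝒢.Cc) (ξ : Ell2 (𝒢.Fiber x)) (g : 𝒢.Fiber x) :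
    𝒢.rho x f ξ g = 𝒢.conv f ξ g :=
  ((exists_rho f.2).2.choose_spec.2 x).choose_spec.2 ξ g

theorem bddAbove_norm_rho (f : 𝒢.Cc) : BddAbove (range fun x => ‖𝒢.rho x f‖) := by
  refine ⟨(exists_rho f.2).2.choose, ?_⟩
  rintro _ ⟨x, rfl⟩
  exact ((exists_rho f.2).2.choose_spec.2 x).choose_spec.1

/-- The C*-algebra of bounded families `(T_x)_x` of operators `T_x` on `ℓ²(𝒢_x)`, `x ∈ 𝒢⁽⁰⁾`, with
the supremum norm and pointwise operations. -/
def Families : Type _ := lp (fun x : X => Ell2 (𝒢.Fiber x) →L[ℂ] Ell2 (𝒢.Fiber x)) ∞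

noncomputable instance : NonUnitalCStarAlgebra 𝒢.Families :=
  inferInstanceAs (NonUnitalCStarAlgebra
    (lp (fun x : X => Ell2 (𝒢.Fiber x) →L[ℂ] Ell2 (𝒢.Fiber x)) ∞))

/-- The family `(ρ_x(f))_x`, whose norm is `‖f‖_r = sup_x ‖ρ_x(f)‖`. -/
noncomputable def regRep (f : 𝒢.Cc) : 𝒢.Families :=
  ⟨fun x => 𝒢.rho x f, memℓp_infty (𝒢.bddAbove_norm_rho f)⟩

/-- The reduced C*-algebra `C*_r(𝒢)`: the completion of `C_c(𝒢)` with respect to the norm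
`‖f‖_r = sup_x ‖ρ_x(f)‖`, realised as the C*-algebra generated by the families `(ρ_x(f))_x`,
`f ∈ C_c(𝒢)`. -/
noncomputable def reducedAlgebra : NonUnitalStarSubalgebra ℂ 𝒢.Families :=
  (NonUnitalStarAlgebra.adjoin ℂ (range 𝒢.regRep)).topologicalClosure

/-- The representation `ρ_x`, as the `x`-th component map. -/
noncomputable def rhoHom (x : X) :
    𝒢.Families →⋆ₙₐ[ℂ] (Ell2 (𝒢.Fiber x) →L[ℂ] Ell2 (𝒢.Fiber x)) where
  toFun a := a.1 x
  map_smul' _ _ := rfl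
  map_zero' := rfl
  map_add' _ _ := rfl
  map_mul' _ _ := rfl
  map_star' _ := rfl

/-- The unit `x`, as an element of `𝒢_x`. -/
def unitAt (x : X) : 𝒢.Fiber x := ⟨𝒢.one x, 𝒢.src_one x⟩

/-- The set of `x ∈ 𝒢⁽⁰⁾` with `ρ_x(a) δ_x ≠ 0`. -/
def singSupport (a : 𝒢.Families) : Set X := {x | 𝒢.rhoHom x a (delta (𝒢.unitAt x)) ≠ 0}

theorem continuous_rhoHom (x : X) : Continuous (𝒢.rhoHom x) :=
  (lp.evalCLM ℂ (fun x : X => Ell2 (𝒢.Fiber x) →L[ℂ] Ell2 (𝒢.Fiber x)) ∞ x).continuous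

theorem rhoHom_regRep (x : X) (f : 𝒢.Cc) : 𝒢.rhoHom x (𝒢.regRep f) = 𝒢.rho x f := rfl

theorem families_ext {a b : 𝒢.Families} (h : ∀ x, 𝒢.rhoHom x a = 𝒢.rhoHom x b) : a = b :=
  lp.ext (funext h)

theorem regRep_add (f f' : 𝒢.Cc) : 𝒢.regRep (f + f') = 𝒢.regRep f + 𝒢.regRep f' := by
  refine 𝒢.families_ext fun x => ?_
  rw [map_add, rhoHom_regRep, rhoHom_regRep, rhoHom_regRep]
  ext ξ g
  exact (𝒢.rho_apply _ _ _ _).trans ((conv_add_left (exists_rho f.2).1 (exists_rho f'.2).1 ξ g).trans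
    (congrArg₂ _ (𝒢.rho_apply _ _ _ _) (𝒢.rho_apply _ _ _ _)).symm)

theorem regRep_smul (c : ℂ) (f : 𝒢.Cc) : 𝒢.regRep (c • f) = c • 𝒢.regRep f := by
  refine 𝒢.families_ext fun x => ?_
  rw [map_smul, rhoHom_regRep, rhoHom_regRep]
  ext ξ g
  exact (𝒢.rho_apply _ _ _ _).trans ((conv_smul_left _ c ξ g).trans
    (congrArg _ (𝒢.rho_apply _ _ _ _)).symm)

theorem inv_one (x : X) : 𝒢.inv (𝒢.one x) = 𝒢.one x := by
  have h1 := 𝒢.mul_one (𝒢.inv (𝒢.one x))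
  have h2 := 𝒢.inv_mul (𝒢.one x)
  have h3 : 𝒢.one (𝒢.src (𝒢.inv (𝒢.one x))) = 𝒢.one x :=
    congrArg 𝒢.one ((𝒢.src_inv _).trans (𝒢.rng_one x))
  rw [← h1, mul_congr rfl h3, h2, 𝒢.src_one]

theorem inv_inv (k : G) : 𝒢.inv (𝒢.inv k) = k := by
  have e1 := 𝒢.mul_assoc k (𝒢.inv k) (𝒢.inv (𝒢.inv k)) (𝒢.rng_inv k).symm
    (𝒢.rng_inv (𝒢.inv k)).symm
  have e2 := 𝒢.mul_inv (𝒢.inv k)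
  have e3 := 𝒢.mul_one k
  have e4 := 𝒢.one_mul (𝒢.inv (𝒢.inv k))
  have h1 : 𝒢.rng (𝒢.inv k) = 𝒢.src k := 𝒢.rng_inv k
  have h2 : 𝒢.rng k = 𝒢.rng (𝒢.inv (𝒢.inv k)) := by rw [𝒢.rng_inv, 𝒢.src_inv]
  rw [← e4]
  refine (mul_congr ((congrArg 𝒢.one h2.symm).trans (𝒢.mul_inv k).symm) rfl _).trans (e1.trans ?_)
  exact (mul_congr rfl (e2.trans (congrArg 𝒢.one h1)) _).trans e3

theorem mulRight_unitAt {x : X} (k : 𝒢.Fiber x) :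
    fiberEquiv k (𝒢.unitAt (𝒢.rng k.1)) = k := Subtype.ext (𝒢.one_mul k.1)

theorem divRight_unitAt {x : X} (g : 𝒢.Fiber x) : (𝒢.divRight (𝒢.unitAt x) g).1 = g.1 :=
  (mul_congr rfl ((𝒢.inv_one x).trans (congrArg 𝒢.one g.2.symm)) _).trans (𝒢.mul_one g.1)

theorem unitAt_divRight {x : X} (g : 𝒢.Fiber x) :
    (𝒢.divRight g (𝒢.unitAt x)).1 = 𝒢.inv g.1 := by
  have h : 𝒢.one x = 𝒢.one (𝒢.rng (𝒢.inv g.1)) := by rw [𝒢.rng_inv, g.2]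
  exact (mul_congr h rfl _).trans (𝒢.one_mul (𝒢.inv g.1))

theorem rhoHom_delta {a : 𝒢.Families} (ha : a ∈ 𝒢.reducedAlgebra) {x : X} (k : 𝒢.Fiber x) :
    𝒢.rhoHom x a (delta k) = ell2Congr (fiberEquiv k)
      (𝒢.rhoHom (𝒢.rng k.1) a (delta (𝒢.unitAt (𝒢.rng k.1)))) := by
  let W := ell2Congr (fiberEquiv k)
  let ψ : 𝒢.Families →⋆ₙₐ[ℂ] (Ell2 (𝒢.Fiber x) →L[ℂ] Ell2 (𝒢.Fiber x)) :=
    (W.conjStarAlgEquiv : _ →⋆ₙₐ[ℂ] _).comp (𝒢.rhoHom (𝒢.rng k.1))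
  have hψ : ∀ (b : 𝒢.Families) (ξ), ψ b (W ξ) = W (𝒢.rhoHom (𝒢.rng k.1) b ξ) := by
    intro b ξ
    have h1 : ψ b (W ξ) = W (𝒢.rhoHom (𝒢.rng k.1) b (W.symm (W ξ))) := rfl
    rw [h1, W.symm_apply_apply]
  have hc : Continuous ψ := by
    have : Isometry W.conjStarAlgEquiv := NonUnitalStarAlgHom.isometry _ W.conjStarAlgEquiv.injective
    exact this.continuous.comp (𝒢.continuous_rhoHom _)
  have hle : 𝒢.reducedAlgebra ≤ NonUnitalStarAlgHom.equalizer (𝒢.rhoHom x) ψ := by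
    refine NonUnitalStarSubalgebra.topologicalClosure_minimal _ (NonUnitalStarAlgebra.adjoin_le ?_)
      (isClosed_eq (𝒢.continuous_rhoHom x) hc)
    rintro _ ⟨f, rfl⟩
    refine (NonUnitalStarAlgHom.mem_equalizer _ _ _).2 (ContinuousLinearMap.ext fun η => ?_)
    obtain ⟨ξ, rfl⟩ := W.surjective η
    rw [hψ, rhoHom_regRep, rhoHom_regRep]
    ext g
    rw [rho_apply]
    exact (conv_congr f k ξ g).trans (𝒢.rho_apply _ _ _ _).symm
  have h := (NonUnitalStarAlgHom.mem_equalizer _ _ _).1 (hle ha)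
  rw [h]
  have h2 : delta k = W (delta (𝒢.unitAt (𝒢.rng k.1))) := by
    rw [ell2Congr_delta, mulRight_unitAt]
  rw [h2, hψ]

/-- The right multipliers `b` of the set of elements with meager `singSupport`. -/
def IsGood (b : 𝒢.Families) : Prop := ∀ a ∈ 𝒢.reducedAlgebra,
  IsMeagre (𝒢.singSupport a) → IsMeagre (𝒢.singSupport (a * b))

theorem isGood_of_bisection {T : 𝒢.Families} {U : Set G} (hU : IsOpen U) {p q : G → X}
    (hp : IsLocalHomeomorph p) (hq : IsLocalHomeomorph q) (hinj : InjOn p U)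
    (H : ∀ x, 𝒢.rhoHom x T (delta (𝒢.unitAt x)) = 0 ∨ ∃ g ∈ U, p g = x ∧ ∃ k : 𝒢.Fiber x,
      𝒢.rng k.1 = q g ∧ ∃ c : ℂ, 𝒢.rhoHom x T (delta (𝒢.unitAt x)) = c • delta k) :
    𝒢.IsGood T := by
  intro a ha hm
  have h1 : IsMeagre ((fun u : U => q u) ⁻¹' 𝒢.singSupport a) :=
    hm.preimage_of_isOpenMap (hq.continuous.comp continuous_subtype_val)
      (hq.isOpenMap.comp hU.isOpenMap_subtype_val)
  have hemb : IsOpenEmbedding fun u : U => p u :=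
    .of_continuous_injective_isOpenMap (hp.continuous.comp continuous_subtype_val)
      (fun u v h => Subtype.ext (hinj u.2 v.2 h)) (hp.isOpenMap.comp hU.isOpenMap_subtype_val)
  refine (hemb.isInducing.isMeagre_image h1).mono fun x hx => ?_
  have hx' : 𝒢.rhoHom x a (𝒢.rhoHom x T (delta (𝒢.unitAt x))) ≠ 0 := by
    have : 𝒢.rhoHom x (a * T) (delta (𝒢.unitAt x)) ≠ 0 := hx
    rwa [map_mul] at this
  rcases H x with h | ⟨g, hg, hgx, k, hk, c, h⟩
  · rw [h, map_zero] at hx'; exact absurd rfl hx'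
  · rw [h, map_smul, 𝒢.rhoHom_delta ha] at hx'
    refine ⟨⟨g, hg⟩, ?_, hgx⟩
    change 𝒢.rhoHom (q g) a (delta (𝒢.unitAt (q g))) ≠ 0
    rw [← hk]
    intro h0
    rw [h0, map_zero, smul_zero] at hx'
    exact hx' rfl

theorem singSupport_add (a b : 𝒢.Families) :
    𝒢.singSupport (a + b) ⊆ 𝒢.singSupport a ∪ 𝒢.singSupport b := by
  intro x hx
  by_contra hn
  simp only [mem_union, singSupport, mem_ofPred_eq, not_or, not_not] at hn
  refine hx ?_
  rw [map_add, _root_.add_apply, hn.1, hn.2, add_zero]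

theorem singSupport_smul (c : ℂ) (a : 𝒢.Families) :
    𝒢.singSupport (c • a) ⊆ 𝒢.singSupport a := by
  intro x hx h
  refine hx ?_
  rw [map_smul, _root_.smul_apply, h, smul_zero]

theorem singSupport_mul (a b : 𝒢.Families) :
    𝒢.singSupport (a * b) ⊆ 𝒢.singSupport b := by
  intro x hx h
  refine hx ?_
  rw [map_mul, mul_apply_eq_comp, h, map_zero]

theorem singSupport_zero : 𝒢.singSupport 0 = ∅ := by
  ext x; simp [singSupport]

theorem singSupport_star (a : 𝒢.Families) :
    𝒢.singSupport (star a) ⊆ 𝒢.singSupport (a * star a) := by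
  intro x hx h
  refine hx ?_
  rw [map_mul, mul_apply_eq_comp] at h
  rw [← inner_self_eq_zero (𝕜 := ℂ)]
  conv_lhs => rw [map_star, ContinuousLinearMap.star_eq_adjoint,
    ContinuousLinearMap.adjoint_inner_left, ← ContinuousLinearMap.star_eq_adjoint, ← map_star, h,
    inner_zero_right]

theorem isGood_add {b b' : 𝒢.Families} (h : 𝒢.IsGood b) (h' : 𝒢.IsGood b') :
    𝒢.IsGood (b + b') := fun a ha hm => by
  rw [mul_add]
  exact ((h a ha hm).union (h' a ha hm)).mono (𝒢.singSupport_add _ _)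

theorem isGood_smul (c : ℂ) {b : 𝒢.Families} (h : 𝒢.IsGood b) : 𝒢.IsGood (c • b) :=
  fun a ha hm => by
  rw [mul_smul_comm]
  exact (h a ha hm).mono (𝒢.singSupport_smul _ _)

theorem isGood_zero : 𝒢.IsGood 0 := fun a _ _ => by
  rw [mul_zero, singSupport_zero]; exact IsMeagre.empty

theorem isGood_regRep_of_mem_CcOn {U : Set G} (hU : 𝒢.IsOpenBisection U) {f : G → ℂ}
    (hf : f ∈ CcOn U) (hf' : f ∈ 𝒢.Cc) :
    𝒢.IsGood (𝒢.regRep ⟨f, hf'⟩) ∧ 𝒢.IsGood (star (𝒢.regRep ⟨f, hf'⟩)) := by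
  have hfU : ∀ g, f g ≠ 0 → g ∈ U := by
    obtain ⟨-, K, -, hKU, hK⟩ := hf
    exact fun g hg => hKU (by_contra fun hn => hg (hK g hn))
  constructor
  · refine 𝒢.isGood_of_bisection hU.1 𝒢.isLocalHomeomorph_src 𝒢.isLocalHomeomorph_rng hU.2.1
      fun x => ?_
    have hv : ∀ g : 𝒢.Fiber x, 𝒢.rho x ⟨f, hf'⟩ (delta (𝒢.unitAt x)) g = f g.1 := fun g => by
      rw [rho_apply, conv_delta, divRight_unitAt]
    rw [rhoHom_regRep]
    by_cases hk : ∃ k : 𝒢.Fiber x, k.1 ∈ U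
    · obtain ⟨k, hk⟩ := hk
      refine .inr ⟨k.1, hk, k.2, k, rfl, f k.1, ?_⟩
      ext g
      rw [hv, lp.coeFn_smul, Pi.smul_apply]
      by_cases hgk : g = k
      · subst hgk; rw [delta_apply_self]; simp
      · rw [delta_apply_ne hgk, smul_zero]
        by_contra hne
        exact hgk (Subtype.ext (hU.2.1 (hfU _ hne) hk (g.2.trans k.2.symm)))
    · refine .inl ?_
      ext g
      rw [hv]
      by_contra hne
      exact hk ⟨g, hfU _ hne⟩
  · refine 𝒢.isGood_of_bisection hU.1 𝒢.isLocalHomeomorph_rng 𝒢.isLocalHomeomorph_src hU.2.2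
      fun x => ?_
    have hv : ∀ g : 𝒢.Fiber x, (star (𝒢.rho x ⟨f, hf'⟩)) (delta (𝒢.unitAt x)) g =
        star (f (𝒢.inv g.1)) := fun g => by
      rw [← inner_delta, ContinuousLinearMap.star_eq_adjoint,
        ContinuousLinearMap.adjoint_inner_right, ← inner_conj_symm, inner_delta, rho_apply,
        conv_delta, unitAt_divRight]
      rfl
    rw [map_star, rhoHom_regRep]
    by_cases hk : ∃ h ∈ U, 𝒢.rng h = x
    · obtain ⟨h, hh, hx⟩ := hk
      refine .inr ⟨h, hh, hx, ⟨𝒢.inv h, (𝒢.src_inv h).trans hx⟩, 𝒢.rng_inv h, star (f h), ?_⟩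
      ext g
      rw [hv, lp.coeFn_smul, Pi.smul_apply]
      by_cases hgk : g = ⟨𝒢.inv h, (𝒢.src_inv h).trans hx⟩
      · have h1 : delta g g = 1 := delta_apply_self g
        rw [hgk] at h1 ⊢
        rw [h1, smul_eq_mul, _root_.mul_one]
        exact congrArg (fun z => star (f z)) (𝒢.inv_inv h)
      · rw [delta_apply_ne hgk, smul_zero]
        by_contra hne
        have hne' : f (𝒢.inv g.1) ≠ 0 := fun h0 => hne (by rw [h0, star_zero])
        have := hU.2.2 (hfU _ hne') hh (((𝒢.rng_inv _).trans g.2).trans hx.symm)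
        refine hgk (Subtype.ext ?_)
        change g.1 = 𝒢.inv h
        rw [← this, inv_inv]
    · refine .inl ?_
      ext g
      rw [hv]
      by_contra hne
      have hne' : f (𝒢.inv g.1) ≠ 0 := fun h0 => hne (by rw [h0, star_zero]; rfl)
      exact hk ⟨_, hfU _ hne', (𝒢.rng_inv _).trans g.2⟩

theorem isGood_regRep (f : 𝒢.Cc) : 𝒢.IsGood (𝒢.regRep f) ∧ 𝒢.IsGood (star (𝒢.regRep f)) := by
  obtain ⟨f, hf⟩ := f
  induction hf using Submodule.span_induction with
  | mem f h =>
    have h' := h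
    simp only [mem_iUnion, mem_ofPred_eq, exists_prop] at h'
    obtain ⟨U, hU, hf⟩ := h'
    exact 𝒢.isGood_regRep_of_mem_CcOn hU hf _
  | zero =>
    have : 𝒢.regRep ⟨0, zero_mem _⟩ = 0 := by
      have := 𝒢.regRep_smul 0 0
      rwa [zero_smul, zero_smul] at this
    rw [this, star_zero]
    exact ⟨𝒢.isGood_zero, 𝒢.isGood_zero⟩
  | add f f' hf hf' h h' =>
    have := 𝒢.regRep_add ⟨f, hf⟩ ⟨f', hf'⟩
    have e : 𝒢.regRep ⟨f + f', add_mem hf hf'⟩ = _ := this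
    rw [e, star_add]
    exact ⟨𝒢.isGood_add h.1 h'.1, 𝒢.isGood_add h.2 h'.2⟩
  | smul c f hf h =>
    have := 𝒢.regRep_smul c ⟨f, hf⟩
    have e : 𝒢.regRep ⟨c • f, Submodule.smul_mem _ c hf⟩ = _ := this
    rw [e, star_smul]
    exact ⟨𝒢.isGood_smul _ h.1, 𝒢.isGood_smul _ h.2⟩

theorem isGood_of_mem {b : 𝒢.Families} (hb : b ∈ 𝒢.reducedAlgebra) : 𝒢.IsGood b := by
  have h1 : ∀ b ∈ NonUnitalStarAlgebra.adjoin ℂ (range 𝒢.regRep), 𝒢.IsGood b := by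
    intro b hb
    rw [← SetLike.mem_coe, ← NonUnitalStarSubalgebra.coe_toNonUnitalSubalgebra,
      NonUnitalStarAlgebra.adjoin_toNonUnitalSubalgebra, SetLike.mem_coe] at hb
    induction hb using NonUnitalAlgebra.adjoin_induction with
    | mem b hb =>
      rcases (mem_union _ _ _).1 hb with ⟨f, rfl⟩ | hf
      · exact (𝒢.isGood_regRep f).1
      · obtain ⟨f, hf⟩ := Set.mem_star.1 hf
        rw [← star_star b, ← hf]; exact (𝒢.isGood_regRep f).2
    | add b b' hb hb' h h' => exact 𝒢.isGood_add h h'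
    | zero => exact 𝒢.isGood_zero
    | mul b b' hb hb' h h' =>
      rw [← NonUnitalStarAlgebra.adjoin_toNonUnitalSubalgebra] at hb
      intro a ha hm
      rw [← _root_.mul_assoc]
      exact h' _ (mul_mem ha (NonUnitalStarSubalgebra.le_topologicalClosure _ hb)) (h a ha hm)
    | smul c b hb h => exact 𝒢.isGood_smul c h
  intro a ha hm
  obtain ⟨u, hu, hlim⟩ := mem_closure_iff_seq_limit.1 hb
  refine (isMeagre_iUnion fun n => h1 (u n) (hu n) a ha hm).mono fun x hx => ?_
  by_contra hn
  simp only [mem_iUnion, not_exists, singSupport, mem_ofPred_eq, not_not] at hn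
  have hc : Continuous fun b : 𝒢.Families => 𝒢.rhoHom x (a * b) (delta (𝒢.unitAt x)) :=
    ((𝒢.continuous_rhoHom x).comp (continuous_const.mul continuous_id)).clm_apply continuous_const
  have := (hc.tendsto b).comp hlim
  refine hx (tendsto_nhds_unique this ?_)
  refine tendsto_const_nhds.congr fun n => (hn n).symm

end EtaleGroupoid

/-- A self-adjoint two-sided ideal in a complex `*`-algebra. -/
structure StarIdeal (A : Type*) [NonUnitalRing A] [StarRing A] [Module ℂ A] extends
    Submodule ℂ A where
  mul_mem_left : ∀ a b : A, b ∈ carrier → a * b ∈ carrier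
  mul_mem_right : ∀ a b : A, a ∈ carrier → a * b ∈ carrier
  star_mem : ∀ a : A, a ∈ carrier → star a ∈ carrier

namespace StarIdeal

variable {A : Type*} [NonUnitalRing A] [StarRing A] [Module ℂ A]

/-- The quotient `*`-algebra `A / J`. -/
def Quot (J : StarIdeal A) : Type _ := A ⧸ J.toSubmodule

variable (J : StarIdeal A)

instance : AddCommGroup J.Quot := inferInstanceAs (AddCommGroup (A ⧸ J.toSubmodule))

instance : Module ℂ J.Quot := inferInstanceAs (Module ℂ (A ⧸ J.toSubmodule))

/-- The quotient map, as a linear map. -/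
def mkₗ : A →ₗ[ℂ] J.Quot := J.toSubmodule.mkQ

theorem mkₗ_eq_iff (a b : A) : J.mkₗ a = J.mkₗ b ↔ a - b ∈ J.toSubmodule :=
  Submodule.Quotient.eq J.toSubmodule

theorem mkₗ_surjective : Function.Surjective J.mkₗ := J.toSubmodule.mkQ_surjective

instance : Mul J.Quot := ⟨Quotient.map₂ (· * ·) (by
  intro a a' h b b' h'
  have h1 := (J.mkₗ_eq_iff a a').1 (Quotient.sound h)
  have h2 := (J.mkₗ_eq_iff b b').1 (Quotient.sound h')
  refine Quotient.exact ((J.mkₗ_eq_iff _ _).2 ?_)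
  have : a * b - a' * b' = (a - a') * b + a' * (b - b') := by rw [sub_mul, mul_sub]; abel
  rw [this]
  exact J.add_mem (J.mul_mem_right _ _ h1) (J.mul_mem_left _ _ h2))⟩

instance : Star J.Quot := ⟨Quotient.map star (by
  intro a a' h
  have h1 := (J.mkₗ_eq_iff a a').1 (Quotient.sound h)
  refine Quotient.exact ((J.mkₗ_eq_iff _ _).2 ?_)
  rw [← star_sub]
  exact J.star_mem _ h1)⟩

theorem mkₗ_mul (a b : A) : J.mkₗ (a * b) = J.mkₗ a * J.mkₗ b := rfl

theorem mkₗ_star (a : A) : J.mkₗ (star a) = star (J.mkₗ a) := rfl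

instance : NonUnitalRing J.Quot where
  left_distrib x y z := by
    obtain ⟨a, rfl⟩ := J.mkₗ_surjective x
    obtain ⟨b, rfl⟩ := J.mkₗ_surjective y
    obtain ⟨c, rfl⟩ := J.mkₗ_surjective z
    simp only [← map_add, ← mkₗ_mul, mul_add]
  right_distrib x y z := by
    obtain ⟨a, rfl⟩ := J.mkₗ_surjective x
    obtain ⟨b, rfl⟩ := J.mkₗ_surjective y
    obtain ⟨c, rfl⟩ := J.mkₗ_surjective z
    simp only [← map_add, ← mkₗ_mul, add_mul]
  zero_mul x := by
    obtain ⟨a, rfl⟩ := J.mkₗ_surjective x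
    rw [← map_zero J.mkₗ, ← mkₗ_mul, zero_mul]
  mul_zero x := by
    obtain ⟨a, rfl⟩ := J.mkₗ_surjective x
    rw [← map_zero J.mkₗ, ← mkₗ_mul, mul_zero]
  mul_assoc x y z := by
    obtain ⟨a, rfl⟩ := J.mkₗ_surjective x
    obtain ⟨b, rfl⟩ := J.mkₗ_surjective y
    obtain ⟨c, rfl⟩ := J.mkₗ_surjective z
    simp only [← mkₗ_mul, mul_assoc]

instance : StarRing J.Quot where
  star_involutive x := by
    obtain ⟨a, rfl⟩ := J.mkₗ_surjective x
    rw [← mkₗ_star, ← mkₗ_star, star_star]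
  star_mul x y := by
    obtain ⟨a, rfl⟩ := J.mkₗ_surjective x
    obtain ⟨b, rfl⟩ := J.mkₗ_surjective y
    simp only [← mkₗ_mul, ← mkₗ_star, star_mul]
  star_add x y := by
    obtain ⟨a, rfl⟩ := J.mkₗ_surjective x
    obtain ⟨b, rfl⟩ := J.mkₗ_surjective y
    simp only [← map_add, ← mkₗ_star, star_add]

instance [IsScalarTower ℂ A A] : IsScalarTower ℂ J.Quot J.Quot where
  smul_assoc c x y := by
    obtain ⟨a, rfl⟩ := J.mkₗ_surjective x
    obtain ⟨b, rfl⟩ := J.mkₗ_surjective y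
    simp only [smul_eq_mul, ← map_smul, ← mkₗ_mul, smul_mul_assoc]

instance [SMulCommClass ℂ A A] : SMulCommClass ℂ J.Quot J.Quot where
  smul_comm c x y := by
    obtain ⟨a, rfl⟩ := J.mkₗ_surjective x
    obtain ⟨b, rfl⟩ := J.mkₗ_surjective y
    simp only [smul_eq_mul, ← map_smul, ← mkₗ_mul, mul_smul_comm]

instance [StarModule ℂ A] : StarModule ℂ J.Quot where
  star_smul c x := by
    obtain ⟨a, rfl⟩ := J.mkₗ_surjective x
    simp only [← map_smul, ← mkₗ_star, star_smul]

/-- The quotient `*`-homomorphism `A → A / J`. -/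
def quotHom : A →⋆ₙₐ[ℂ] J.Quot where
  toFun := J.mkₗ
  map_smul' := map_smul J.mkₗ
  map_zero' := map_zero J.mkₗ
  map_add' := map_add J.mkₗ
  map_mul' := J.mkₗ_mul
  map_star' := J.mkₗ_star

end StarIdeal

namespace EtaleGroupoid

variable {G X : Type*} [TopologicalSpace G] [TopologicalSpace X] (𝒢 : EtaleGroupoid G X)

/-- The ideal `J_sing` of `C*_r(𝒢)`: the elements `a` such that the set of `x ∈ 𝒢⁽⁰⁾` with
`ρ_x(a) δ_x ≠ 0` is meager. -/
def singularIdeal : StarIdeal 𝒢.reducedAlgebra where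
  carrier := {a | IsMeagre {x | 𝒢.rhoHom x a (delta (𝒢.unitAt x)) ≠ 0}}
  add_mem' {a b} ha hb := (IsMeagre.union ha hb).mono (𝒢.singSupport_add a b)
  zero_mem' := by
    have : IsMeagre (𝒢.singSupport 0) := by rw [singSupport_zero]; exact IsMeagre.empty
    exact this
  smul_mem' c a ha := IsMeagre.mono (𝒢.singSupport_smul c a) ha
  mul_mem_left a b hb := IsMeagre.mono (𝒢.singSupport_mul a b) hb
  mul_mem_right a b ha := 𝒢.isGood_of_mem b.2 a a.2 ha
  star_mem a ha := IsMeagre.mono (𝒢.singSupport_star a)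
    (𝒢.isGood_of_mem (star_mem a.2) a a.2 ha)

/-- The essential C*-algebra `C*_ess(𝒢) = C*_r(𝒢) / J_sing`, as a `*`-algebra (its C*-norm is
determined by the `*`-algebra structure). -/
abbrev EssentialAlgebra : Type _ := 𝒢.singularIdeal.Quot

/-- For a bijection `e : ι → 𝒢_x`, the representation `ρ_x` viewed as a representation on `ℓ²(ι)`
by means of the unitary `ℓ²(ι) → ℓ²(𝒢_x)`, `δ_i ↦ δ_{e i}`. -/
noncomputable def rhoOn {ι : Type*} {x : X} (e : ι ≃ 𝒢.Fiber x) :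
    𝒢.reducedAlgebra →⋆ₙₐ[ℂ] (Ell2 ι →L[ℂ] Ell2 ι) :=
  ((ell2Congr e).symm.conjStarAlgEquiv : _ →⋆ₙₐ[ℂ] _).comp
    ((𝒢.rhoHom x).comp (NonUnitalStarSubalgebraClass.subtype 𝒢.reducedAlgebra))

end EtaleGroupoid

namespace LCMonoid

variable {S : Type*} [LeftCancelMonoid S]

/-! ### The fibre over `χ_e` and the reduced C*-algebra of `S` -/

theorem InHull.map_mul {g : S ≃. S} (hg : InHull g) :
    ∀ {a b : S} (t : S), g a = some b → g (a * t) = some (b * t) := by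
  induction hg with
  | leftMul s =>
    intro a b t h
    have h' : s * a = b := Option.some.inj h
    subst h'
    exact congrArg some (mul_assoc s a t).symm
  | comp g h _ _ ihg ihh =>
    intro a b t H
    obtain ⟨c, h1, h2⟩ := (PEquiv.trans_eq_some _ _ _ _).1 H
    exact (PEquiv.trans_eq_some _ _ _ _).2 ⟨c * t, ihh t h1, ihg t h2⟩
  | symm g _ ih =>
    intro a b t H
    exact (PEquiv.eq_some_iff g).2 (ih t ((PEquiv.eq_some_iff g).1 H))

namespace GermSystem

variable (N : GermSystem S)

theorem dom_of (s : S) (χ : Omega S) : χ (Hull.of s).dom = true :=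
  χ.map_mono (fun t _ => ⟨s * t, rfl⟩) χ.map_dom_one

/-- The element `[s, χ_e]` of the fibre over `χ_e`. -/
noncomputable def germAt (s : S) : N.groupoid.Fiber (Omega.pt 1) :=
  ⟨germ (Hull.of s) (Omega.pt 1) (dom_of s _), rfl⟩

theorem germAt_bijective : Function.Bijective N.germAt := by
  constructor
  · intro s t h
    obtain ⟨A, hA, H⟩ := (germ_eq_germ _ _).1 (congrArg Subtype.val h)
    have h1 : (some (s * 1) : Option S) = some (t * 1) := H 1 (N.mem_of_pt 1 A hA)
    simpa using h1
  · rintro ⟨a, ha⟩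
    obtain ⟨g, χ, hg, rfl⟩ := exists_germ a
    obtain rfl : χ = Omega.pt 1 := ha
    obtain ⟨s, hs⟩ := (Omega.pt_apply 1 g.dom).1 hg
    refine ⟨s, Subtype.ext (germ_congr _ ?_ rfl)⟩
    refine Hull.ext' fun t => ?_
    have := InHull.map_mul g.2 t hs
    rw [_root_.one_mul] at this
    rw [this]; rfl

/-- The bijection `s ↦ [s, χ_e]` of `S` onto the fibre over `χ_e`. -/
noncomputable def fibreEquiv : S ≃ N.groupoid.Fiber (Omega.pt 1) :=
  Equiv.ofBijective N.germAt N.germAt_bijective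

/-- The representation `ρ_{χ_e}` of `C*_r` of the groupoid on `ℓ²(S)`, by means of the
identification of `S` with the fibre over `χ_e`, `s ↦ [s, χ_e]`. -/
noncomputable def rhoE : N.groupoid.reducedAlgebra →⋆ₙₐ[ℂ] (Ell2 S →L[ℂ] Ell2 S) :=
  N.groupoid.rhoOn N.fibreEquiv

end GermSystem

/-- The left regular representation, `λ_s δ_t = δ_{st}`. -/
noncomputable def leftReg (s : S) : Ell2 S →L[ℂ] Ell2 S :=
  (ell2Map (fun t => s * t) (mul_right_injective s)).toContinuousLinearMap

theorem leftReg_delta (s t : S) : leftReg s (delta t) = delta (s * t) :=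
  ell2Map_delta (fun t => s * t) (mul_right_injective s) t

variable (S) in
/-- The reduced C*-algebra `C*_r(S)`, generated by the operators `λ_s`, `s ∈ S`. -/
noncomputable def reducedAlgebra : NonUnitalStarSubalgebra ℂ (Ell2 S →L[ℂ] Ell2 S) :=
  (NonUnitalStarAlgebra.adjoin ℂ (range (leftReg (S := S)))).topologicalClosure

end LCMonoid

/-!
For either groupoid `𝒢`, the operator of the characteristic function of `D(g, Ω(S))` is
multiplicative in `g`, and the closed span of these operators is `C*_r(𝒢)`. As `ρ_{χ_e}` sends the
operator of a left translation `s` to `λ_s`, and `*`-homomorphisms have closed range, its image is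
`C*_r(S)`.

The kernel of `ρ_{χ_e}` is `J_sing`. An element `a` of `C*_r(𝒢)` is determined by its coefficient
function `g ↦ (ρ_{s(g)}(a) δ_{s(g)})(g)` on `𝒢`, a uniform limit of functions in `C_c(𝒢)`, hence
continuous off a meagre set. If `ρ_{χ_e}(a) = 0`, the coefficient function vanishes over the dense
set of all `χ_s`, so wherever it is continuous, and `a ∈ J_sing`. Conversely, the hypothesis on
units says that no set `D(g, Ω(S))` has the unit `χ_e` on its boundary, so that coefficient
functions are continuous at `χ_e`. By the Baire category theorem those of elements of `J_sing`
vanish there; applied to `λ_t* a λ_s` in place of `a`, this kills every matrix coefficient of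
`ρ_{χ_e}(a)`.
-/

/-! ### Operators on `ℓ²` -/

namespace Ell2

variable {ι : Type*}

theorem norm_delta (i : ι) : ‖delta i‖ = 1 :=
  (orthonormal_delta id Function.injective_id).1 i

theorem clm_ext {E : Type*} [AddCommGroup E] [TopologicalSpace E] [T2Space E] [Module ℂ E]
    {T T' : Ell2 ι →L[ℂ] E} (h : ∀ i, T (delta i) = T' (delta i)) : T = T' := by
  classical
  refine lp.ext_continuousLinearMap (by simp) fun i => ContinuousLinearMap.ext_ring ?_
  have hi := h i
  unfold delta at hi
  simp only [ContinuousLinearMap.comp_apply, lp.singleContinuousLinearMap_apply]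
  convert hi

theorem star_apply_delta (T : Ell2 ι →L[ℂ] Ell2 ι) (i j : ι) :
    (star T) (delta i) j = star (T (delta j) i) := by
  rw [← inner_delta, ContinuousLinearMap.star_eq_adjoint,
    ContinuousLinearMap.adjoint_inner_right, ← inner_conj_symm, inner_delta]
  rfl

end Ell2

/-! ### `*`-homomorphisms of C*-algebras have closed range -/

section Range

variable {A B : Type*} [NonUnitalCStarAlgebra A] [NonUnitalCStarAlgebra B]

theorem exists_map_eq_norm_le_of_isSelfAdjoint (φ : A →⋆ₙₐ[ℂ] B) {a : A}
    (ha : IsSelfAdjoint a) : ∃ a', φ a' = φ a ∧ ‖a'‖ ≤ ‖φ a‖ := by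
  have hφa : IsSelfAdjoint (φ a) := ha.map φ
  -- Cutting the spectrum of `a` off at `±‖φ a‖` does not change `φ a`.
  let cutoff : ℝ → ℝ := fun t => max (-‖φ a‖) (min t ‖φ a‖)
  have cutoff_continuous : Continuous cutoff := by fun_prop
  have cutoff_zero : cutoff 0 = 0 := by simp [cutoff]
  have φ_continuous : Continuous φ := AddMonoidHomClass.continuous_of_bound φ 1 fun a => by
    simpa only [one_mul] using NonUnitalStarAlgHom.norm_apply_le φ a
  refine ⟨cfcₙ cutoff a, ?_, norm_cfcₙ_le fun t _ => abs_le.2 ⟨le_max_left _ _, ?_⟩⟩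
  · rw [NonUnitalStarAlgHom.map_cfcₙ (S := ℂ) φ cutoff a cutoff_continuous.continuousOn
      cutoff_zero φ_continuous ha hφa]
    conv_rhs => rw [← cfcₙ_id' ℝ (φ a)]
    refine cfcₙ_congr fun t ht => ?_
    have ht' : |t| ≤ ‖φ a‖ :=
      NonUnitalIsometricContinuousFunctionalCalculus.norm_quasispectrum_le (φ a) ht hφa
    change max _ (min t _) = t
    rw [min_eq_left (abs_le.1 ht').2, max_eq_right (abs_le.1 ht').1]
  · exact max_le (neg_le_self (norm_nonneg _)) (min_le_right _ _)

theorem exists_map_eq_norm_le_two_mul (φ : A →⋆ₙₐ[ℂ] B) (a : A) :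
    ∃ a', φ a' = φ a ∧ ‖a'‖ ≤ 2 * ‖φ a‖ := by
  obtain ⟨x, hx, hx'⟩ := exists_map_eq_norm_le_of_isSelfAdjoint φ (realPart a).2
  obtain ⟨y, hy, hy'⟩ := exists_map_eq_norm_le_of_isSelfAdjoint φ (imaginaryPart a).2
  rw [map_realPart] at hx hx'
  rw [map_imaginaryPart] at hy hy'
  refine ⟨x + Complex.I • y, ?_, ?_⟩
  · rw [map_add, map_smul, hx, hy, realPart_add_I_smul_imaginaryPart]
  · calc ‖x + Complex.I • y‖ ≤ ‖x‖ + ‖y‖ := by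
          simpa only [norm_smul, Complex.norm_I, one_mul] using norm_add_le x (Complex.I • y)
      _ ≤ ‖φ a‖ + ‖φ a‖ := add_le_add (hx'.trans (realPart.norm_le (φ a)))
          (hy'.trans (imaginaryPart.norm_le (φ a)))
      _ = 2 * ‖φ a‖ := (two_mul _).symm

theorem isClosed_range_nonUnitalStarAlgHom (φ : A →⋆ₙₐ[ℂ] B) : IsClosed (range φ) := by
  let f : NormedAddGroupHom A B :=
    { toFun := φ
      map_add' := map_add φ
      bound' := ⟨1, fun a => by simpa only [one_mul] using NonUnitalStarAlgHom.norm_apply_le φ a⟩ }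
  refine isClosed_of_closure_subset fun b hb => ?_
  obtain ⟨a, ha, -⟩ := controlled_closure_of_complete (f := f) (K := f.range) two_pos one_pos
    (by rintro _ ⟨a, rfl⟩; exact exists_map_eq_norm_le_two_mul φ a) b hb
  exact ⟨a, ha⟩

end Range

theorem StarIdeal.exists_starAlgEquiv {A B : Type*} [NonUnitalRing A] [StarRing A] [Module ℂ A]
    [NonUnitalRing B] [StarRing B] [Module ℂ B] (J : StarIdeal A) (φ : A →⋆ₙₐ[ℂ] B)
    (hker : ∀ a, φ a = 0 ↔ a ∈ J.toSubmodule) (hsurj : Function.Surjective φ) :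
    ∃ Φ : J.Quot ≃⋆ₐ[ℂ] B, ∀ a, Φ (J.quotHom a) = φ a := by
  let ψ : J.Quot →ₗ[ℂ] B := J.toSubmodule.liftQ (φ : A →ₗ[ℂ] B) fun a ha => (hker a).2 ha
  have hψ (a : A) : ψ (J.mkₗ a) = φ a := rfl
  let Ψ : J.Quot →⋆ₙₐ[ℂ] B :=
    { toFun := ψ
      map_smul' := map_smul ψ
      map_zero' := map_zero ψ
      map_add' := map_add ψ
      map_mul' := J.mkₗ_surjective.forall₂.2 fun a b => by
        rw [← J.mkₗ_mul, hψ, hψ, hψ, map_mul]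
      map_star' := J.mkₗ_surjective.forall.2 fun a => by
        rw [← J.mkₗ_star, hψ, hψ, map_star] }
  have injective : Function.Injective Ψ := by
    refine (injective_iff_map_eq_zero Ψ).2 (J.mkₗ_surjective.forall.2 fun a ha => ?_)
    have ha' : a ∈ J.toSubmodule := (hker a).1 ha
    rwa [← map_zero J.mkₗ, J.mkₗ_eq_iff, sub_zero]
  have surjective : Function.Surjective Ψ := fun b =>
    (hsurj b).imp' J.mkₗ fun a ha => (hψ a).trans ha
  exact ⟨StarAlgEquiv.ofBijective Ψ ⟨injective, surjective⟩, hψ⟩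

/-! ### Coefficient functions on an étale groupoid -/

namespace EtaleGroupoid

variable {G X : Type*} [TopologicalSpace G] [TopologicalSpace X] {𝒢 : EtaleGroupoid G X}

theorem mem_Cc {U : Set G} (hU : 𝒢.IsOpenBisection U) {f : G → ℂ} (hf : f ∈ CcOn U) : f ∈ 𝒢.Cc :=
  Submodule.subset_span (mem_biUnion hU hf)

theorem norm_regRep_le {U : Set G} (hU : 𝒢.IsOpenBisection U) {f : 𝒢.Cc} (hf : f.1 ∈ CcOn U)
    {C : ℝ} (hC0 : 0 ≤ C) (hC : ∀ g, ‖f.1 g‖ ≤ C) : ‖𝒢.regRep f‖ ≤ C := by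
  refine lp.norm_le_of_forall_le hC0 fun x => ?_
  refine ContinuousLinearMap.opNorm_le_bound _ hC0 fun ξ => ?_
  refine lp.norm_le_of_forall_sum_le (by simp) (mul_nonneg hC0 (norm_nonneg _)) fun s => ?_
  refine le_trans (le_of_eq (Finset.sum_congr rfl fun g _ => ?_)) (sum_conv_le hU hf hC ξ s)
  exact congrArg (fun z : ℂ => ‖z‖ ^ (2 : ℝ≥0∞).toReal) (𝒢.rho_apply x f ξ g)

theorem divRight_val_eq_iff {x : X} (k m : 𝒢.Fiber x) (g : G) (H : 𝒢.src g = 𝒢.rng k.1) :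
    (𝒢.divRight k m).1 = g ↔ 𝒢.mul g k.1 H = m.1 := by
  constructor
  · rintro rfl
    exact inv_mul_cancel_right (m.2.trans k.2.symm)
  · intro h
    exact (mul_congr h.symm rfl _).trans (mul_inv_cancel_right H)

variable (𝒢) in
theorem regRep_mem (f : 𝒢.Cc) : 𝒢.regRep f ∈ 𝒢.reducedAlgebra :=
  subset_closure (NonUnitalStarAlgebra.subset_adjoin ℂ _ ⟨f, rfl⟩)

variable (𝒢) in
/-- `regRep` as a linear map. -/
noncomputable def regRepₗ : 𝒢.Cc →ₗ[ℂ] 𝒢.Families where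
  toFun := 𝒢.regRep
  map_add' := 𝒢.regRep_add
  map_smul' := 𝒢.regRep_smul

variable (𝒢) in
/-- The coefficient `(ρ_x(a) δ_x)(g)`, `x = s(g)`, which extends the evaluation `f ↦ f(g)` from
`C_c(𝒢)` to families of operators. On `C*_r(𝒢)` this is Renault's identification of the elements
of `C*_r(𝒢)` with functions on `𝒢`. -/
noncomputable def coeff (g : G) : 𝒢.Families →L[ℂ] ℂ :=
  LinearMap.mkContinuous
    { toFun := fun a => 𝒢.rhoHom (𝒢.src g) a (delta (𝒢.unitAt _)) ⟨g, rfl⟩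
      map_add' := fun _ _ => rfl
      map_smul' := fun _ _ => rfl } 1 fun a => by
    refine (lp.norm_apply_le_norm two_ne_zero _ _).trans ?_
    refine (ContinuousLinearMap.le_opNorm _ _).trans ?_
    rw [Ell2.norm_delta, _root_.mul_one, _root_.one_mul]
    exact lp.norm_apply_le_norm ENNReal.top_ne_zero a _

theorem norm_coeff_apply_le (g : G) (a : 𝒢.Families) : ‖𝒢.coeff g a‖ ≤ ‖a‖ :=
  ((𝒢.coeff g).le_of_opNorm_le (LinearMap.mkContinuous_norm_le _ zero_le_one _) a).trans_eq
    (_root_.one_mul _)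

theorem coeff_val {x : X} (k : 𝒢.Fiber x) (a : 𝒢.Families) :
    𝒢.coeff k.1 a = 𝒢.rhoHom x a (delta (𝒢.unitAt x)) k := by
  obtain ⟨g, rfl⟩ := k
  rfl

theorem coeff_regRep (g : G) (f : 𝒢.Cc) : 𝒢.coeff g (𝒢.regRep f) = f.1 g :=
  (𝒢.rho_apply _ _ _ _).trans <| (conv_delta _ _ _).trans <| congrArg f.1 (𝒢.divRight_unitAt _)

theorem rhoHom_delta_apply {a : 𝒢.Families} (ha : a ∈ 𝒢.reducedAlgebra) {x : X}
    (k m : 𝒢.Fiber x) : 𝒢.rhoHom x a (delta k) m = 𝒢.coeff (𝒢.divRight k m).1 a := by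
  rw [𝒢.rhoHom_delta ha, ell2Congr_apply, coeff_val]
  rfl

theorem coeff_star {a : 𝒢.Families} (ha : a ∈ 𝒢.reducedAlgebra) (g : G) :
    𝒢.coeff g (star a) = star (𝒢.coeff (𝒢.inv g) a) := by
  let k : 𝒢.Fiber (𝒢.src g) := ⟨g, rfl⟩
  change 𝒢.rhoHom _ (star a) (delta (𝒢.unitAt _)) k = _
  rw [map_star, Ell2.star_apply_delta, rhoHom_delta_apply ha, 𝒢.unitAt_divRight]

theorem eq_of_coeff_eq {a b : 𝒢.Families} (ha : a ∈ 𝒢.reducedAlgebra)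
    (hb : b ∈ 𝒢.reducedAlgebra) (h : ∀ g, 𝒢.coeff g a = 𝒢.coeff g b) : a = b := by
  refine 𝒢.families_ext fun x => Ell2.clm_ext fun k => ?_
  ext m
  rw [rhoHom_delta_apply ha, rhoHom_delta_apply hb, h]

theorem singSupport_eq_image (a : 𝒢.Families) :
    𝒢.singSupport a = 𝒢.src '' {g | 𝒢.coeff g a ≠ 0} := by
  ext x
  constructor
  · intro hx
    obtain ⟨k, hk⟩ : ∃ k, 𝒢.rhoHom x a (delta (𝒢.unitAt x)) k ≠ 0 := by
      by_contra! h
      exact hx (lp.ext (funext h))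
    exact ⟨k.1, (coeff_val k a).trans_ne hk, k.2⟩
  · rintro ⟨g, hg, rfl⟩ h
    refine hg ?_
    change 𝒢.rhoHom _ a (delta (𝒢.unitAt _)) _ = 0
    rw [h]
    rfl

theorem continuousAt_coeff_of_mem_closure {T : Set 𝒢.Families} {a : 𝒢.Families}
    (ha : a ∈ closure T) {g : G} (hT : ∀ b ∈ T, ContinuousAt (𝒢.coeff · b) g) :
    ContinuousAt (𝒢.coeff · a) g := by
  refine continuousAt_of_locally_uniform_approx_of_continuousAt fun u hu => ?_
  obtain ⟨ε, ε_pos, hε⟩ := Metric.mem_uniformity_dist.1 hu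
  obtain ⟨b, hb, hab⟩ := Metric.mem_closure_iff.1 ha ε ε_pos
  refine ⟨univ, Filter.univ_mem, (𝒢.coeff · b), hT b hb, fun k _ => hε ?_⟩
  calc dist (𝒢.coeff k a) (𝒢.coeff k b) = ‖𝒢.coeff k (a - b)‖ := by rw [dist_eq_norm, map_sub]
    _ ≤ ‖a - b‖ := norm_coeff_apply_le k _
    _ < ε := by rwa [← dist_eq_norm]

/-! ### Meagre singular supports -/

theorem continuousAt_of_mem_CcOn {U : Set G} (hU : IsOpen U) {f : G → ℂ} (hf : f ∈ CcOn U) {g : G}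
    (hg : g ∉ frontier U) : ContinuousAt f g := by
  obtain ⟨f_cont, K, -, hKU, hK⟩ := hf
  by_cases hgU : g ∈ U
  · exact f_cont.continuousAt (hU.mem_nhds hgU)
  · have hg' : (closure U)ᶜ ∈ 𝓝 g :=
      isClosed_closure.isOpen_compl.mem_nhds fun h => hg (hU.frontier_eq ▸ ⟨h, hgU⟩)
    have f_zero : f =ᶠ[𝓝 g] 0 := by
      filter_upwards [hg'] with k hk
      exact hK k fun hkK => hk (subset_closure (hKU hkK))
    exact continuousAt_const.congr f_zero.symm

theorem isMeagre_setOf_not_continuousAt {f : G → ℂ} (hf : f ∈ 𝒢.Cc) :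
    IsMeagre {g | ¬ ContinuousAt f g} := by
  induction hf using Submodule.span_induction with
  | mem f hf =>
    obtain ⟨U, hU, hfU⟩ := mem_iUnion₂.1 hf
    have frontier_nowhereDense : IsNowhereDense (frontier U) :=
      isClosed_frontier.isNowhereDense_iff.2 <| by
        rw [← frontier_compl, interior_frontier hU.1.isClosed_compl]
    exact frontier_nowhereDense.isMeagre.mono fun g hg =>
      by_contra fun hgU => hg (continuousAt_of_mem_CcOn hU.1 hfU hgU)
  | zero => exact IsMeagre.empty.mono fun g hg => hg continuousAt_const
  | add f f' _ _ hf hf' =>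
    refine (hf.union hf').mono fun g hg => ?_
    by_contra! h
    exact hg (((not_not.1 fun hn => h (.inl hn)).add (not_not.1 fun hn => h (.inr hn))))
  | smul c f _ hf => exact hf.mono fun g hg (hfg : ContinuousAt f g) => hg (hfg.const_smul c)

theorem IsOpenBisection.isMeagre_image_src {U M : Set G} (hU : 𝒢.IsOpenBisection U)
    (hM : IsMeagre M) : IsMeagre (𝒢.src '' (M ∩ U)) := by
  have src_embedding : IsOpenEmbedding (U.domRestrict 𝒢.src) :=
    .of_continuous_injective_isOpenMap
      (𝒢.isLocalHomeomorph_src.continuous.comp continuous_subtype_val) hU.2.1.injective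
      (𝒢.isLocalHomeomorph_src.isOpenMap.domRestrict hU.1)
  have hM' : IsMeagre (Subtype.val ⁻¹' M : Set U) :=
    hM.preimage_of_isOpenMap continuous_subtype_val hU.1.isOpenMap_subtype_val
  have h := src_embedding.isInducing.isMeagre_image hM'
  rwa [domRestrict_eq, image_comp, Subtype.image_preimage_coe, inter_comm] at h

theorem isMeagre_image_src_inter_support {f : G → ℂ} (hf : f ∈ 𝒢.Cc) {M : Set G}
    (hM : IsMeagre M) : IsMeagre (𝒢.src '' (M ∩ f.support)) := by
  induction hf using Submodule.span_induction with
  | mem f hf =>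
    obtain ⟨U, hU, -, K, -, hKU, hK⟩ := mem_iUnion₂.1 hf
    refine (IsOpenBisection.isMeagre_image_src hU hM).mono (image_mono ?_)
    exact inter_subset_inter_right M fun g hg => hKU (not_imp_comm.1 (hK g) hg)
  | zero => simp only [Function.support_zero, inter_empty, image_empty, IsMeagre.empty]
  | add f f' _ _ hf hf' =>
    refine (hf.union hf').mono ?_
    rw [← image_union, ← inter_union_distrib_left]
    exact image_mono (inter_subset_inter_right M (Function.support_add f f'))
  | smul c f _ hf =>
    exact hf.mono (image_mono (inter_subset_inter_right M (Function.support_const_smul_subset c f)))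

theorem isMeagre_singSupport {a : 𝒢.Families} (ha : a ∈ closure (range 𝒢.regRep)) {Y : Set X}
    (hY : Dense Y) (hYa : Disjoint Y (𝒢.singSupport a)) : IsMeagre (𝒢.singSupport a) := by
  rw [singSupport_eq_image] at hYa ⊢
  obtain ⟨b, hb, hba⟩ := mem_closure_iff_seq_limit.1 ha
  choose f hf using hb
  obtain rfl : (fun n => 𝒢.regRep (f n)) = b := funext hf
  have f_tendsto (g : G) : Filter.Tendsto (fun n => (f n).1 g) .atTop (𝓝 (𝒢.coeff g a)) := by
    simpa only [Function.comp_def, coeff_regRep] using ((𝒢.coeff g).continuous.tendsto a).comp hba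
  let M : Set G := ⋃ n, {g | ¬ ContinuousAt (f n).1 g}
  have hM : IsMeagre M := isMeagre_iUnion fun n => isMeagre_setOf_not_continuousAt (f n).2
  have support_subset_M {g : G} (hg : 𝒢.coeff g a ≠ 0) : g ∈ M := by
    -- Off `M` the function `g ↦ coeff g a` is continuous, and it vanishes on the dense `s⁻¹(Y)`.
    by_contra hgM
    simp only [M, mem_iUnion, mem_ofPred_eq, not_exists, not_not] at hgM
    have coeff_continuousAt : ContinuousAt (𝒢.coeff · a) g :=
      continuousAt_coeff_of_mem_closure
        (mem_closure_of_tendsto hba (.of_forall fun n => mem_range_self n))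
        (forall_mem_range.2 fun n => by simpa only [coeff_regRep] using hgM n)
    obtain ⟨k, hkY, hk⟩ := (hY.preimage 𝒢.isLocalHomeomorph_src.isOpenMap).inter_nhds_nonempty
      (coeff_continuousAt.eventually_ne hg)
    exact hYa.le_bot ⟨hkY, k, hk, rfl⟩
  refine (isMeagre_iUnion fun n => isMeagre_image_src_inter_support (f n).2 hM).mono ?_
  rintro _ ⟨g, hg, rfl⟩
  obtain ⟨n, hn⟩ := ((f_tendsto g).eventually_ne hg).exists
  exact mem_iUnion.2 ⟨n, g, ⟨support_subset_M hg, hn⟩, rfl⟩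

theorem coeff_one_eq_zero {a : 𝒢.Families} (ha : IsMeagre (𝒢.singSupport a)) {x : X}
    (hx : ContinuousAt (𝒢.coeff · a) (𝒢.one x)) : 𝒢.coeff (𝒢.one x) a = 0 := by
  have := 𝒢.t2Space
  have := 𝒢.locallyCompactSpace
  by_contra hne
  have mem_singSupport : 𝒢.singSupport a ∈ 𝓝 x := by
    have hx' : ContinuousAt (fun y => 𝒢.coeff (𝒢.one y) a) x :=
      ContinuousAt.comp (f := 𝒢.one) hx 𝒢.continuous_one.continuousAt
    filter_upwards [hx'.eventually_ne hne] with y hy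
    rw [singSupport_eq_image]
    exact ⟨𝒢.one y, hy, 𝒢.src_one y⟩
  exact not_isMeagre_of_isOpen isOpen_interior ⟨x, mem_interior_iff_mem_nhds.2 mem_singSupport⟩
    (ha.mono interior_subset)

end EtaleGroupoid

/-! ### The left inverse hull and the space `Ω(S)` -/

namespace LCMonoid

variable {S : Type*} [LeftCancelMonoid S]

theorem CIdeal.mul_mem {X : CIdeal S} {s : S} (hs : s ∈ X) (t : S) : s * t ∈ X :=
  ((idOn_eq_some X.1 _ _).1 (InHull.map_mul X.2 t ((idOn_eq_some X.1 s s).2 ⟨rfl, hs⟩))).2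

namespace Hull

theorem of_apply (s t : S) : (of s).1 t = some (s * t) := rfl

theorem eq_of_of_apply_one {g : Hull S} {s : S} (h : g.1 1 = some s) : g = of s :=
  ext' fun t => by rw [of_apply, ← InHull.map_mul g.2 t h, one_mul]

theorem mul_of {g : Hull S} {s t : S} (h : g.1 s = some t) : g * of s = of t :=
  eq_of_of_apply_one <| by rw [mul_apply, of_apply, mul_one, Option.bind_some, h]

/-- The idempotent `p_X` as an element of `I_ℓ(S)`. -/
noncomputable def idem (X : CIdeal S) : Hull S := ⟨idOn X.1, X.2⟩

theorem mul_idem_eq_some (g : Hull S) (X : CIdeal S) (t r : S) :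
    (g * idem X).1 t = some r ↔ t ∈ X ∧ g.1 t = some r := by
  rw [mul_apply, Option.bind_eq_some_iff]
  simp only [idem, idOn_eq_some]
  exact ⟨fun ⟨_, ⟨e, ht⟩, h⟩ => ⟨ht, e ▸ h⟩, fun ⟨ht, h⟩ => ⟨t, ⟨rfl, ht⟩, h⟩⟩

theorem mul_idem_apply (g : Hull S) {X : CIdeal S} {t : S} (ht : t ∈ X) :
    (g * idem X).1 t = g.1 t :=
  Option.ext fun r => (mul_idem_eq_some g X t r).trans (and_iff_right ht)

theorem dom_mul_idem (g : Hull S) (X : CIdeal S) : (g * idem X).dom = g.dom ⊓ X :=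
  SetLike.ext fun t => by
    simp only [mem_dom, mul_idem_eq_some, CIdeal.mem_inf, exists_and_left, and_comm]

end Hull

namespace Omega

instance : TotallyDisconnectedSpace (Omega S) :=
  inferInstanceAs (TotallyDisconnectedSpace {_χ : {_χ : CIdeal S → Bool // _} // _})

theorem dense_range_pt : Dense (range (pt (S := S))) := fun χ => by
  have val_inducing : IsInducing (fun χ : Omega S => χ.1) := .subtypeVal
  rw [val_inducing.closure_eq_preimage_closure_image, mem_preimage, ← range_comp]
  exact χ.2

/-- The characteristic function of `{χ | χ(p_X) = 1}`. -/
noncomputable def char (X : CIdeal S) : C(Omega S, ℂ) :=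
  ⟨{χ | χ X = true}.indicator 1, (isClopen_setOf X).continuous_indicator continuous_one⟩

theorem char_apply (X : CIdeal S) (χ : Omega S) : char X χ = if χ X = true then 1 else 0 := by
  classical exact indicator_apply _ _ _

theorem char_inf (X Y : CIdeal S) : char (X ⊓ Y) = char X * char Y := by
  ext χ
  simp only [ContinuousMap.mul_apply, char_apply, map_inf, ite_and, ite_mul, one_mul, zero_mul]

theorem char_dom_one : char (1 : Hull S).dom = 1 :=
  ContinuousMap.ext fun χ => (char_apply _ χ).trans (if_pos χ.map_dom_one)

theorem star_char (X : CIdeal S) : star (char X) = char X := by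
  ext χ
  rw [ContinuousMap.star_apply, char_apply, apply_ite star, star_one, star_zero]

theorem exists_char_ne {χ ψ : Omega S} (h : χ ≠ ψ) : ∃ X : CIdeal S, char X χ ≠ char X ψ := by
  contrapose! h
  refine ext' fun X => Bool.eq_iff_iff.2 ?_
  have hX := h X
  simp only [char_apply] at hX
  split_ifs at hX <;> simp_all

theorem adjoin_range_char : StarAlgebra.adjoin ℂ (range (char (S := S))) =
    (Submodule.span ℂ (range (char (S := S))) : Set C(Omega S, ℂ)) := by
  let M : Submonoid C(Omega S, ℂ) :=
    { carrier := range char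
      one_mem' := ⟨_, char_dom_one⟩
      mul_mem' := by
        rintro _ _ ⟨X, rfl⟩ ⟨Y, rfl⟩
        exact ⟨X ⊓ Y, char_inf X Y⟩ }
  have star_range : star (range (char (S := S))) = range char := by
    rw [← image_star, ← range_comp]
    exact congrArg range (funext star_char)
  have h := StarAlgebra.adjoin_eq_span (R := ℂ) (range (char (S := S)))
  rw [star_range, union_self, show Submonoid.closure (range char) = M from M.closure_eq] at h
  exact congrArg (fun p : Submodule ℂ C(Omega S, ℂ) => (p : Set C(Omega S, ℂ))) h

theorem topologicalClosure_span_char :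
    (Submodule.span ℂ (range (char (S := S)))).topologicalClosure = ⊤ := by
  refine SetLike.coe_injective ?_
  rw [Submodule.topologicalClosure_coe, ← adjoin_range_char,
    ← StarSubalgebra.topologicalClosure_coe,
    ContinuousMap.starSubalgebra_topologicalClosure_eq_top_of_separatesPoints]
  · rfl
  · intro χ ψ h
    obtain ⟨X, hX⟩ := exists_char_ne h
    exact ⟨_, ⟨char X, StarAlgebra.subset_adjoin _ _ ⟨X, rfl⟩, rfl⟩, hX⟩

end Omega

end LCMonoid

namespace LCMonoid.GermSystem

variable {S : Type*} [LeftCancelMonoid S] (N : GermSystem S)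

/-! ### The elements of the reduced algebra given by the bisections `D(g, Ω(S))` -/

section BasicSet

variable {N}

theorem mem_basicSet_iff {g : Hull S} {U : Set (Omega S)} {a : N.Germ} :
    a ∈ basicSet N g U ↔ src a ∈ U ∧ ∃ h : src a g.dom = true, a = germ g (src a) h :=
  ⟨by rintro ⟨χ, hχ, h, rfl⟩; exact ⟨hχ, h, rfl⟩, fun ⟨hχ, h, e⟩ => ⟨_, hχ, h, e⟩⟩

theorem isOpenBisection_basicSet (g : Hull S) {U : Set (Omega S)} (hU : IsOpen U) :
    N.groupoid.IsOpenBisection (basicSet N g U) := by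
  refine ⟨isOpen_basicSet g hU, ?_, ?_⟩
  · rintro _ ⟨χ, -, hχ, rfl⟩ _ ⟨ψ, -, hψ, rfl⟩ (e : χ = ψ)
    exact germ_congr hχ rfl e
  · rintro _ ⟨χ, -, hχ, rfl⟩ _ ⟨ψ, -, hψ, rfl⟩ (e : Omega.act g χ hχ = Omega.act g ψ hψ)
    refine germ_congr hχ rfl ?_
    rw [← Omega.act_inv_act g χ hχ, ← Omega.act_inv_act g ψ hψ]
    simp only [e]

theorem isCompact_basicSet (g : Hull S) : IsCompact (basicSet N g univ) := by
  have : CompactSpace {χ : Omega S // χ g.dom = true} :=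
    isCompact_iff_compactSpace.1 (Omega.isClopen_setOf g.dom).isClosed.isCompact
  convert isCompact_range (continuous_sect (N := N) g)
  ext a
  constructor
  · rintro ⟨χ, -, hχ, rfl⟩
    exact ⟨⟨χ, hχ⟩, rfl⟩
  · rintro ⟨χ, rfl⟩
    exact ⟨χ.1, trivial, χ.2, rfl⟩

theorem basicSet_mul_idem (g : Hull S) (X : CIdeal S) :
    basicSet N (g * Hull.idem X) univ = basicSet N g {χ | χ X = true} := by
  have dom_iff (χ : Omega S) : χ (g * Hull.idem X).dom = true ↔ χ g.dom = true ∧ χ X = true := by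
    rw [Hull.dom_mul_idem, χ.map_inf]
  have germ_eq {χ : Omega S} (h : χ (g * Hull.idem X).dom = true) :
      (germ (g * Hull.idem X) χ h : N.Germ) = germ g χ ((dom_iff χ).1 h).1 :=
    (germ_eq_germ _ _).2 ⟨_, N.of_mem χ X ((dom_iff χ).1 h).2, fun t ht =>
      Hull.mul_idem_apply g ht⟩
  ext a
  constructor
  · rintro ⟨χ, -, h, rfl⟩
    exact ⟨χ, ((dom_iff χ).1 h).2, ((dom_iff χ).1 h).1, germ_eq h⟩
  · rintro ⟨χ, hX, h, rfl⟩
    exact ⟨χ, trivial, (dom_iff χ).2 ⟨h, hX⟩, (germ_eq _).symm⟩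

theorem inv_mem_basicSet_inv {g : Hull S} {a : N.Germ} :
    inv a ∈ basicSet N g⁻¹ univ ↔ a ∈ basicSet N g univ := by
  have inv_mem {g : Hull S} {a : N.Germ} (ha : a ∈ basicSet N g univ) :
      inv a ∈ basicSet N g⁻¹ univ := by
    obtain ⟨χ, -, h, rfl⟩ := ha
    exact ⟨_, trivial, Omega.dom_inv_act g χ h, rfl⟩
  exact ⟨fun h => inv_inv a ▸ inv_mem h, inv_mem⟩

theorem dom_of_dom_mul {g h : Hull S} {χ : Omega S} (H : χ (g * h).dom = true) :
    χ h.dom = true := by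
  rw [Omega.mul_dom] at H
  refine χ.map_mono (fun t ht => ?_) H
  obtain ⟨r, -, hr⟩ := (Hull.mem_preim _ _ _).1 ht
  exact ⟨r, hr⟩

end BasicSet

/-- The function on germs supported on `D(g, Ω(S))`, with value `φ(χ)` at `[g, χ]`. -/
noncomputable def bumpFun (g : Hull S) (φ : C(Omega S, ℂ)) : N.Germ → ℂ :=
  (basicSet N g univ).indicator fun a => φ (src a)

theorem bumpFun_mem_CcOn (g : Hull S) (φ : C(Omega S, ℂ)) :
    N.bumpFun g φ ∈ EtaleGroupoid.CcOn (basicSet N g univ) :=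
  ⟨(φ.continuous.comp continuous_src).continuousOn.congr fun _ ha => indicator_of_mem ha _,
    _, isCompact_basicSet g, subset_rfl, fun _ ha => indicator_of_notMem ha _⟩

/-- `bumpFun` as an element of `C_c` of the groupoid, depending linearly on the function on
`Ω(S)`. -/
noncomputable def bump (g : Hull S) : C(Omega S, ℂ) →ₗ[ℂ] N.groupoid.Cc where
  toFun φ := ⟨N.bumpFun g φ,
    EtaleGroupoid.mem_Cc (isOpenBisection_basicSet g isOpen_univ) (N.bumpFun_mem_CcOn g φ)⟩
  map_add' φ ψ := Subtype.ext (indicator_add _ (fun a => φ (src a)) fun a => ψ (src a))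
  map_smul' c φ := Subtype.ext (indicator_const_smul _ c fun a => φ (src a))

/-- The image of `bump g φ` in `C*_r` of the groupoid, as a bounded linear function of `φ`. -/
noncomputable def sectionOp (g : Hull S) : C(Omega S, ℂ) →L[ℂ] N.groupoid.Families :=
  LinearMap.mkContinuous (N.groupoid.regRepₗ ∘ₗ N.bump g) 1 fun φ => by
    rw [_root_.one_mul]
    refine EtaleGroupoid.norm_regRep_le (isOpenBisection_basicSet g isOpen_univ)
      (N.bumpFun_mem_CcOn g φ) (norm_nonneg _) fun a => ?_
    exact (norm_indicator_le_norm_self (fun a => φ (src a)) a).trans (φ.norm_coe_le_norm _)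

/-- The element of `C*_r` of the groupoid given by the characteristic function of `D(g, Ω(S))`. -/
noncomputable def op (g : Hull S) : N.groupoid.Families := N.sectionOp g 1

theorem op_mem (g : Hull S) : N.op g ∈ N.groupoid.reducedAlgebra :=
  N.groupoid.regRep_mem _

theorem coeff_op (g : Hull S) (a : N.Germ) :
    N.groupoid.coeff a (N.op g) = (basicSet N g univ).indicator 1 a :=
  EtaleGroupoid.coeff_regRep (𝒢 := N.groupoid) a _

theorem sectionOp_char (g : Hull S) (X : CIdeal S) :
    N.sectionOp g (Omega.char X) = N.op (g * Hull.idem X) := by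
  classical
  refine congrArg N.groupoid.regRep (Subtype.ext (funext fun a => ?_))
  change (basicSet N g univ).indicator (fun a => Omega.char X (src a)) a =
    (basicSet N (g * Hull.idem X) univ).indicator 1 a
  simp only [basicSet_mul_idem, indicator_apply, mem_basicSet_iff, mem_univ, true_and,
    Omega.char_apply, mem_ofPred_eq, and_comm (a := src a X = true), ite_and, Pi.one_apply]

variable {N} in
/-- The germ `[g, χ]` as an element of the fibre over `χ`. -/
def fib (g : Hull S) (χ : Omega S) (h : χ g.dom = true) : N.groupoid.Fiber χ := ⟨germ g χ h, rfl⟩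

variable {N} in
theorem exists_fib {χ : Omega S} (k : N.groupoid.Fiber χ) : ∃ g h, k = fib g χ h := by
  obtain ⟨k, rfl⟩ := k
  obtain ⟨g, χ, h, rfl⟩ := exists_germ k
  exact ⟨g, h, rfl⟩

theorem divRight_fib_mem_basicSet_iff (g h : Hull S) {χ : Omega S} (hh : χ h.dom = true)
    (m : N.groupoid.Fiber χ) : (N.groupoid.divRight (fib h χ hh) m).1 ∈ basicSet N g univ ↔
      ∃ hgh : χ (g * h).dom = true, m = fib (g * h) χ hgh := by
  have key (hg : Omega.act h χ hh g.dom = true) :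
      (N.groupoid.divRight (fib h χ hh) m).1 = germ g _ hg ↔ m = fib (g * h) χ (dom_mul hh hg) := by
    rw [EtaleGroupoid.divRight_val_eq_iff _ _ _ rfl]
    exact (Eq.congr_left (mul_germ g h χ hh hg rfl)).trans
      ⟨fun e => Subtype.ext e.symm, fun e => e ▸ rfl⟩
  rw [mem_basicSet_iff]
  have hsrc : src (N.groupoid.divRight (fib h χ hh) m).1 = Omega.act h χ hh :=
    (N.groupoid.divRight (fib h χ hh) m).2
  simp only [hsrc]
  constructor
  · rintro ⟨-, hg, e⟩
    exact ⟨_, (key hg).1 e⟩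
  · rintro ⟨hgh, e⟩
    have hg : Omega.act h χ hh g.dom = true := by rwa [Omega.mul_dom] at hgh
    exact ⟨trivial, hg, (key hg).2 e⟩

theorem op_delta (g h : Hull S) {χ : Omega S} (hh : χ h.dom = true)
    (hgh : χ (g * h).dom = true) :
    N.groupoid.rhoHom χ (N.op g) (delta (fib h χ hh)) = delta (fib (g * h) χ hgh) := by
  ext m
  rw [EtaleGroupoid.rhoHom_delta_apply (N.op_mem g), coeff_op]
  by_cases hm : m = fib (g * h) χ hgh
  · rw [hm, delta_apply_self, indicator_of_mem, Pi.one_apply]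
    exact (N.divRight_fib_mem_basicSet_iff g h hh _).2 ⟨hgh, rfl⟩
  · rw [delta_apply_ne hm, indicator_of_notMem]
    exact fun H => hm ((N.divRight_fib_mem_basicSet_iff g h hh m).1 H).2

theorem op_delta_eq_zero (g h : Hull S) {χ : Omega S} (hh : χ h.dom = true)
    (hgh : ¬ χ (g * h).dom = true) :
    N.groupoid.rhoHom χ (N.op g) (delta (fib h χ hh)) = 0 := by
  ext m
  rw [EtaleGroupoid.rhoHom_delta_apply (N.op_mem g), coeff_op, indicator_of_notMem]
  · rfl
  · exact fun H => hgh ((N.divRight_fib_mem_basicSet_iff g h hh m).1 H).1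

theorem op_mul (g h : Hull S) : N.op g * N.op h = N.op (g * h) := by
  refine N.groupoid.families_ext fun χ => Ell2.clm_ext fun k => ?_
  obtain ⟨k, hk, rfl⟩ := exists_fib k
  rw [map_mul, mul_apply_eq_comp]
  by_cases hhk : χ (h * k).dom = true
  · rw [N.op_delta h k hk hhk]
    by_cases H : χ (g * (h * k)).dom = true
    · have H' : χ (g * h * k).dom = true := by rwa [Hull.mul_assoc']
      rw [N.op_delta g (h * k) hhk H, N.op_delta (g * h) k hk H']
      simp only [Hull.mul_assoc']
    · rw [N.op_delta_eq_zero g _ hhk H, N.op_delta_eq_zero (g * h) k hk]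
      rwa [Hull.mul_assoc']
  · rw [N.op_delta_eq_zero h k hk hhk, map_zero, N.op_delta_eq_zero (g * h) k hk]
    rw [Hull.mul_assoc']
    exact fun H => hhk (dom_of_dom_mul H)

theorem star_op (g : Hull S) : star (N.op g) = N.op g⁻¹ := by
  classical
  refine EtaleGroupoid.eq_of_coeff_eq (star_mem (N.op_mem g)) (N.op_mem _) fun a => ?_
  have key : inv a ∈ basicSet N g univ ↔ a ∈ basicSet N g⁻¹ univ := by
    rw [← inv_mem_basicSet_inv, inv_inv]
  rw [EtaleGroupoid.coeff_star (N.op_mem g), coeff_op, coeff_op, indicator_apply, indicator_apply]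
  change star (if inv a ∈ basicSet N g univ then (1 : ℂ) else 0) = _
  rw [apply_ite star, star_one, star_zero]
  exact if_congr key rfl rfl

/-! ### Density of the span of the elements `op g` -/

/-- The `*`-subalgebra generated by the elements `op g`, `g ∈ I_ℓ(S)`; it is their linear span. -/
noncomputable def opAlgebra : NonUnitalStarSubalgebra ℂ N.groupoid.Families :=
  NonUnitalStarAlgebra.adjoin ℂ (range N.op)

theorem opAlgebra_eq_span : (N.opAlgebra : Set N.groupoid.Families) =
    Submodule.span ℂ (range N.op) := by
  let M : Subsemigroup N.groupoid.Families :=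
    { carrier := range N.op
      mul_mem' := by
        rintro _ _ ⟨g, rfl⟩ ⟨h, rfl⟩
        exact ⟨g * h, (N.op_mul g h).symm⟩ }
  have star_range : star (range N.op) ⊆ range N.op := by
    rintro a ⟨g, hg⟩
    exact ⟨g⁻¹, by rw [← star_op, hg, star_star]⟩
  have h := NonUnitalStarAlgebra.adjoin_eq_span (R := ℂ) (range N.op)
  rw [union_eq_self_of_subset_right star_range,
    show Subsemigroup.closure (range N.op) = M from M.closure_eq] at h
  exact congrArg (fun p : Submodule ℂ N.groupoid.Families => (p : Set N.groupoid.Families)) h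

theorem sectionOp_mem (g : Hull S) (φ : C(Omega S, ℂ)) :
    N.sectionOp g φ ∈ N.opAlgebra.topologicalClosure := by
  have hφ : φ ∈ (Submodule.span ℂ (range (Omega.char (S := S)))).topologicalClosure := by
    rw [Omega.topologicalClosure_span_char]
    trivial
  have span_le : Submodule.span ℂ (range (Omega.char (S := S))) ≤
      N.opAlgebra.toSubmodule.comap (N.sectionOp g).toLinearMap := by
    rw [Submodule.span_le]
    rintro _ ⟨X, rfl⟩
    change N.sectionOp g (Omega.char X) ∈ N.opAlgebra
    rw [sectionOp_char]
    exact NonUnitalStarAlgebra.subset_adjoin ℂ _ ⟨_, rfl⟩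
  exact map_mem_closure (N.sectionOp g).continuous hφ fun ψ hψ => span_le hψ

/-- The functions in `C_c` of the groupoid whose image in `C*_r` lies in the closure of
`opAlgebra`. -/
noncomputable def approximable : Submodule ℂ (N.Germ → ℂ) :=
  (N.opAlgebra.topologicalClosure.toSubmodule.comap N.groupoid.regRepₗ).map N.groupoid.Cc.subtype

theorem bumpFun_mem_approximable (g : Hull S) (φ : C(Omega S, ℂ)) :
    N.bumpFun g φ ∈ N.approximable :=
  ⟨N.bump g φ, N.sectionOp_mem g φ, rfl⟩

variable {N} in
theorem exists_indicator_eq_bumpFun {U : Set N.Germ} (hU : N.groupoid.IsOpenBisection U)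
    {f : N.Germ → ℂ} (hf : f ∈ EtaleGroupoid.CcOn U) {g : Hull S} {W : Set (Omega S)}
    (hW : IsClopen W) (hgW : ∀ χ ∈ W, ∃ h, germ g χ h ∈ U) :
    ∃ φ, (src ⁻¹' W).indicator f = N.bumpFun g φ := by
  classical
  let F : Omega S → ℂ := fun χ => if h : χ g.dom = true then f (germ g χ h) else 0
  have F_continuousOn : ContinuousOn F W := by
    rw [continuousOn_iff_continuous_domRestrict]
    have hF : W.domRestrict F = fun χ : W => f (sect N g ⟨χ, (hgW χ χ.2).1⟩) :=
      funext fun χ => dif_pos _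
    rw [hF]
    exact hf.1.comp_continuous ((continuous_sect g).comp (by fun_prop)) fun χ => (hgW χ χ.2).2
  have φ_continuous : Continuous (W.indicator F) :=
    continuous_indicator (by simp [hW.frontier_eq]) (hW.isClosed.closure_eq.symm ▸ F_continuousOn)
  refine ⟨⟨W.indicator F, φ_continuous⟩, funext fun a => ?_⟩
  change (src ⁻¹' W).indicator f a =
    (basicSet N g univ).indicator (fun a => W.indicator F (src a)) a
  by_cases haW : src a ∈ W
  · rw [indicator_of_mem (show a ∈ src ⁻¹' W from haW)]
    obtain ⟨hg, hgU⟩ := hgW _ haW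
    by_cases hag : a = germ g (src a) hg
    · rw [indicator_of_mem (mem_basicSet_iff.2 ⟨mem_univ _, hg, hag⟩), indicator_of_mem haW]
      exact (congrArg f hag).trans (show F (src a) = _ from dif_pos hg).symm
    · rw [indicator_of_notMem fun h => hag (mem_basicSet_iff.1 h).2.2]
      obtain ⟨-, K, -, hKU, hK⟩ := hf
      exact hK a fun haK => hag (hU.2.1 (hKU haK) hgU rfl)
  · rw [indicator_of_notMem (show a ∉ src ⁻¹' W from haW), indicator_apply,
      indicator_of_notMem haW, ite_self]

variable {N} in
theorem exists_isClopen_indicator_mem_approximable {U : Set N.Germ}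
    (hU : N.groupoid.IsOpenBisection U) {f : N.Germ → ℂ} (hf : f ∈ EtaleGroupoid.CcOn U)
    (χ : Omega S) : ∃ V, IsClopen V ∧ χ ∈ V ∧
      ∀ W ⊆ V, IsClopen W → (src ⁻¹' W).indicator f ∈ N.approximable := by
  obtain ⟨-, K, K_compact, hKU, hK⟩ := id hf
  by_cases hχ : χ ∈ src '' K
  · obtain ⟨a, haK, rfl⟩ := hχ
    obtain ⟨g, χ, hg, rfl⟩ := exists_germ a
    obtain ⟨V, hV, hχV, hVU⟩ := compact_exists_isClopen_in_isOpen
      (isOpen_iff.1 hU.1 g) (show χ ∈ {χ | ∃ h, germ g χ h ∈ U} from ⟨hg, hKU haK⟩)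
    refine ⟨V, hV, hχV, fun W hWV hW => ?_⟩
    obtain ⟨φ, hφ⟩ := exists_indicator_eq_bumpFun hU hf hW fun χ hχ => hVU (hWV hχ)
    exact hφ ▸ N.bumpFun_mem_approximable g φ
  · obtain ⟨V, hV, hχV, hVK⟩ := compact_exists_isClopen_in_isOpen
      (K_compact.image continuous_src).isClosed.isOpen_compl hχ
    refine ⟨V, hV, hχV, fun W hWV _ => ?_⟩
    rw [indicator_eq_zero'.2]
    · exact zero_mem _
    · exact disjoint_left.2 fun a ha haW => hVK (hWV haW) ⟨a, not_imp_comm.1 (hK a) ha, rfl⟩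

theorem Cc_le_approximable : N.groupoid.Cc ≤ N.approximable := by
  refine Submodule.span_le.2 (iUnion₂_subset fun U hU f hf => ?_)
  obtain ⟨V, -, hV, hVf⟩ : ∃ V, IsClopen V ∧ univ ⊆ V ∧
      ∀ W ⊆ V, IsClopen W → (src ⁻¹' W).indicator f ∈ N.approximable := by
    refine isCompact_univ.induction_on (p := fun s => ∃ V, IsClopen V ∧ s ⊆ V ∧
      ∀ W ⊆ V, IsClopen W → (src ⁻¹' W).indicator f ∈ N.approximable) ?_ ?_ ?_ ?_
    · refine ⟨∅, isClopen_empty, subset_rfl, fun W hW _ => ?_⟩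
      rw [subset_empty_iff.1 hW, preimage_empty, indicator_empty]
      exact zero_mem _
    · rintro s t hst ⟨V, hV, htV, hVf⟩
      exact ⟨V, hV, hst.trans htV, hVf⟩
    · rintro s t ⟨V, hV, hsV, hVf⟩ ⟨V', hV', htV', hVf'⟩
      refine ⟨V ∪ V', hV.union hV', union_subset_union hsV htV', fun W hWV hW => ?_⟩
      rw [← inter_union_sdiff W V, preimage_union, indicator_union_of_disjoint]
      · exact add_mem (hVf _ inter_subset_right (hW.inter hV))
          (hVf' _ (sdiff_subset_iff.2 hWV) (hW.diff hV))
      · exact disjoint_sdiff_inter.symm.preimage src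
    · intro χ _
      obtain ⟨V, hV, hχV, hVf⟩ := exists_isClopen_indicator_mem_approximable hU hf χ
      exact ⟨V, mem_nhdsWithin_of_mem_nhds (hV.isOpen.mem_nhds hχV), V, hV, subset_rfl, hVf⟩
  change f ∈ N.approximable
  simpa only [preimage_univ, indicator_univ] using hVf univ hV isClopen_univ

theorem reducedAlgebra_le : N.groupoid.reducedAlgebra ≤ N.opAlgebra.topologicalClosure := by
  refine NonUnitalStarSubalgebra.topologicalClosure_minimal _ (NonUnitalStarAlgebra.adjoin_le ?_)
    (NonUnitalStarSubalgebra.isClosed_topologicalClosure _)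
  rintro _ ⟨f, rfl⟩
  obtain ⟨f', hf', e⟩ := N.Cc_le_approximable f.2
  obtain rfl : f' = f := Subtype.ext e
  exact hf'

end LCMonoid.GermSystem

/-! ### Continuity of the coefficients at `χ_e` -/

namespace LCMonoid

variable {S : Type*} [LeftCancelMonoid S]

theorem Hull.exists_eq_of_unit {g : Hull S} (hg : 1 ∈ g.dom) (hg' : 1 ∈ g⁻¹.dom) :
    ∃ u : Sˣ, g = of (u : S) := by
  obtain ⟨s, hs⟩ := hg
  obtain rfl := eq_of_of_apply_one hs
  obtain ⟨t, ht⟩ := hg'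
  have hst : s * t = 1 := Option.some.inj ((inv_eq_some (of s)).1 ht)
  have hts : t * s = 1 := mul_left_cancel (a := s) (by rw [← mul_assoc, hst, one_mul, mul_one])
  exact ⟨⟨s, t, hst, hts⟩, rfl⟩

namespace Omega

theorem eventually_mem_iff (X : CIdeal S) (t : S) :
    ∀ᶠ s in Filter.comap pt (𝓝 (pt t)), s ∈ X ↔ t ∈ X := by
  have h : ∀ᶠ χ in 𝓝 (pt t), χ X = pt t X :=
    (continuous_apply X).continuousAt.eventually_mem ((isOpen_discrete {pt t X}).mem_nhds rfl)
  filter_upwards [h.comap pt] with s hs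
  rw [← pt_apply, ← pt_apply, hs]

theorem eventually_mul_ne {u : S} {ι : Type*} [Finite ι] {X : ι → CIdeal S}
    (hX : ⋃ i, (X i : Set S) ≠ univ) (hu : ∀ s ∉ ⋃ i, (X i : Set S), u * s ≠ s) :
    ∀ᶠ s in Filter.comap pt (𝓝 (pt 1)), u * s ≠ s := by
  have one_notMem (i : ι) : 1 ∉ X i := fun hi =>
    hX (eq_univ_of_forall fun s => mem_iUnion.2 ⟨i, one_mul s ▸ CIdeal.mul_mem hi s⟩)
  filter_upwards [Filter.eventually_all.2 fun i => eventually_mem_iff (X i) 1] with s hs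
  refine hu s fun h => ?_
  obtain ⟨i, hi⟩ := mem_iUnion.1 h
  exact one_notMem i ((hs i).1 hi)

end Omega

namespace GermSystem

variable {N : GermSystem S}

theorem frequently_apply_eq_some {h : Hull S} {χ : Omega S}
    (hχ : one χ ∈ closure (basicSet N h univ)) :
    ∃ᶠ s in Filter.comap Omega.pt (𝓝 χ), h.1 s = some s := by
  rw [Filter.frequently_comap, Filter.frequently_iff]
  intro U hU
  obtain ⟨V, hVU, hV, hχV⟩ := mem_nhds_iff.1 hU
  obtain ⟨_, ⟨ψ, hψV, h1, rfl⟩, hψ⟩ := mem_closure_iff.1 hχ (basicSet N 1 V)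
    (isOpen_basicSet 1 hV) ⟨χ, hχV, χ.map_dom_one, rfl⟩
  obtain ⟨-, hψh, e⟩ := mem_basicSet_iff.1 hψ
  obtain ⟨A, hA, eqOn⟩ := (germ_eq_germ h1 hψh).1 e
  obtain ⟨_, ⟨hsV, hsA⟩, s, rfl⟩ := Omega.dense_range_pt.inter_open_nonempty
    (V ∩ {ψ | A ∈ N.nhd ψ}) (hV.inter (N.isOpen A)) ⟨ψ, hψV, hA⟩
  refine ⟨Omega.pt s, hVU hsV, s, rfl, ?_⟩
  rw [← eqOn s (N.mem_of_pt s A hsA), Hull.one_val]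
  rfl

theorem one_notMem_frontier_basicSet
    (hfree : ∀ u : Sˣ, u ≠ 1 → ∀ᶠ s in Filter.comap Omega.pt (𝓝 (Omega.pt 1)), (u : S) * s ≠ s)
    (h : Hull S) : one (Omega.pt 1) ∉ frontier (basicSet N h univ) := by
  rw [(isOpen_basicSet h isOpen_univ).frontier_eq]
  rintro ⟨hcl, hone⟩
  have fixed := frequently_apply_eq_some hcl
  have one_mem {X : CIdeal S} (hX : ∀ s, h.1 s = some s → s ∈ X) : 1 ∈ X := by
    obtain ⟨s, hs, hsX⟩ := (fixed.and_eventually (Omega.eventually_mem_iff X 1)).exists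
    exact hsX.1 (hX s hs)
  obtain ⟨u, rfl⟩ := Hull.exists_eq_of_unit (one_mem fun s hs => ⟨s, hs⟩)
    (one_mem fun s hs => ⟨s, (Hull.inv_eq_some h).2 hs⟩)
  obtain rfl | hu := eq_or_ne u 1
  · exact hone ⟨_, mem_univ _, Omega.map_dom_one _, rfl⟩
  · obtain ⟨s, hs, hus⟩ := (fixed.and_eventually (hfree u hu)).exists
    exact hus (Option.some.inj hs)

theorem reducedAlgebra_subset_closure_span :
    (N.groupoid.reducedAlgebra : Set N.groupoid.Families) ⊆
      closure (Submodule.span ℂ (range N.op)) :=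
  N.opAlgebra_eq_span ▸ N.reducedAlgebra_le

theorem continuousAt_coeff_one
    (hfree : ∀ u : Sˣ, u ≠ 1 → ∀ᶠ s in Filter.comap Omega.pt (𝓝 (Omega.pt 1)), (u : S) * s ≠ s)
    {a : N.groupoid.Families} (ha : a ∈ N.groupoid.reducedAlgebra) :
    ContinuousAt (N.groupoid.coeff · a) (one (Omega.pt 1)) := by
  refine EtaleGroupoid.continuousAt_coeff_of_mem_closure
    (reducedAlgebra_subset_closure_span ha) fun b hb => ?_
  induction hb using Submodule.span_induction with
  | mem b hb =>
    obtain ⟨h, rfl⟩ := hb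
    have coeff_eq : (N.groupoid.coeff · (N.op h)) = N.bumpFun h 1 :=
      funext fun a => EtaleGroupoid.coeff_regRep (𝒢 := N.groupoid) a _
    rw [coeff_eq]
    exact EtaleGroupoid.continuousAt_of_mem_CcOn (isOpen_basicSet h isOpen_univ)
      (N.bumpFun_mem_CcOn h 1) (one_notMem_frontier_basicSet hfree h)
  | zero => simpa only [map_zero] using continuousAt_const
  | add b c _ _ hb hc =>
    simp only [map_add]
    exact hb.add hc
  | smul c b _ hb =>
    simp only [map_smul]
    exact hb.const_smul c

end GermSystem

end LCMonoid

/-! ### The representation `ρ_{χ_e}` -/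

theorem EtaleGroupoid.rhoHom_eq_zero_iff {G X : Type*} [TopologicalSpace G] [TopologicalSpace X]
    {𝒢 : EtaleGroupoid G X} {a : 𝒢.Families} (ha : a ∈ 𝒢.reducedAlgebra) {x : X} :
    𝒢.rhoHom x a = 0 ↔ ∀ k : 𝒢.Fiber x, 𝒢.rng k.1 ∉ 𝒢.singSupport a := by
  have delta_eq_zero_iff (k : 𝒢.Fiber x) :
      𝒢.rhoHom x a (delta k) = 0 ↔ 𝒢.rng k.1 ∉ 𝒢.singSupport a := by
    rw [𝒢.rhoHom_delta ha, LinearIsometryEquiv.map_eq_zero_iff]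
    exact not_not.symm
  simp only [← delta_eq_zero_iff]
  exact ⟨fun h k => by rw [h]; rfl, fun h => Ell2.clm_ext h⟩

namespace LCMonoid

variable {S : Type*} [LeftCancelMonoid S]

@[elab_as_elim]
theorem Hull.induction_on {p : Hull S → Prop} (g : Hull S) (of : ∀ s, p (of s))
    (mul : ∀ g h, p g → p h → p (g * h)) (inv : ∀ g, p g → p g⁻¹) : p g := by
  obtain ⟨g, hg⟩ := g
  induction hg with
  | leftMul s => exact of s
  | comp g h hg hh ihg ihh => exact mul ⟨g, hg⟩ ⟨h, hh⟩ ihg ihh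
  | symm g hg ih => exact inv ⟨g, hg⟩ ih

theorem leftReg_mem (s : S) : leftReg s ∈ reducedAlgebra S :=
  subset_closure (NonUnitalStarAlgebra.subset_adjoin ℂ _ ⟨s, rfl⟩)

namespace GermSystem

variable (N : GermSystem S)

/-- The representation `ρ_{χ_e}` on `ℓ²(S)`, on all bounded families of operators; `rhoE` is its
restriction to `C*_r` of the groupoid. -/
noncomputable def rhoEFamilies : N.groupoid.Families →⋆ₙₐ[ℂ] (Ell2 S →L[ℂ] Ell2 S) :=
  ((ell2Congr N.fibreEquiv).symm.conjStarAlgEquiv : _ →⋆ₙₐ[ℂ] _).comp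
    (N.groupoid.rhoHom (Omega.pt 1))

theorem rhoEFamilies_delta (a : N.groupoid.Families) (s : S) :
    N.rhoEFamilies a (delta s) = (ell2Congr N.fibreEquiv).symm
      (N.groupoid.rhoHom (Omega.pt 1) a (delta (N.fibreEquiv s))) := by
  rw [← ell2Congr_delta]
  rfl

theorem rhoEFamilies_delta_one_one (a : N.groupoid.Families) :
    N.rhoEFamilies a (delta 1) 1 = N.groupoid.coeff (one (Omega.pt 1)) a := by
  rw [rhoEFamilies_delta]
  exact (EtaleGroupoid.coeff_val (N.groupoid.unitAt _) a).symm

theorem rhoEFamilies_op_of (s : S) : N.rhoEFamilies (N.op (Hull.of s)) = leftReg s := by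
  refine Ell2.clm_ext fun t => ?_
  have mul_of : Hull.of s * Hull.of t = Hull.of (s * t) := Hull.mul_of rfl
  have mul_dom : Omega.pt (1 : S) (Hull.of s * Hull.of t).dom = true := mul_of ▸ dom_of _ _
  calc N.rhoEFamilies (N.op (Hull.of s)) (delta t)
      = (ell2Congr N.fibreEquiv).symm (delta (fib (Hull.of s * Hull.of t) _ mul_dom)) := by
        rw [rhoEFamilies_delta, ← N.op_delta _ _ (dom_of t _)]
        rfl
    _ = (ell2Congr N.fibreEquiv).symm (delta (N.fibreEquiv (s * t))) :=
        congrArg (fun k => (ell2Congr N.fibreEquiv).symm (delta k))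
          (Subtype.ext (germ_congr _ mul_of rfl))
    _ = leftReg s (delta t) := by
        rw [← ell2Congr_delta, LinearIsometryEquiv.symm_apply_apply, leftReg_delta]

theorem rhoEFamilies_op_mem (g : Hull S) : N.rhoEFamilies (N.op g) ∈ reducedAlgebra S := by
  induction g using Hull.induction_on with
  | of s => exact N.rhoEFamilies_op_of s ▸ leftReg_mem s
  | mul g h hg hh => simpa only [← op_mul, map_mul] using mul_mem hg hh
  | inv g hg => simpa only [← star_op, map_star] using star_mem hg

theorem rhoE_mem (a : N.groupoid.reducedAlgebra) : N.rhoE a ∈ reducedAlgebra S := by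
  have continuous_rhoEFamilies : Continuous N.rhoEFamilies :=
    AddMonoidHomClass.continuous_of_bound N.rhoEFamilies 1 fun a => by
      simpa only [_root_.one_mul] using NonUnitalStarAlgHom.norm_apply_le N.rhoEFamilies a
  have opAlgebra_closure_le : N.opAlgebra.topologicalClosure ≤
      (reducedAlgebra S).comap N.rhoEFamilies := by
    refine NonUnitalStarSubalgebra.topologicalClosure_minimal _
      (NonUnitalStarAlgebra.adjoin_le (range_subset_iff.2 N.rhoEFamilies_op_mem)) ?_
    exact (NonUnitalStarSubalgebra.isClosed_topologicalClosure _).preimage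
      continuous_rhoEFamilies
  exact opAlgebra_closure_le (N.reducedAlgebra_le a.2)

instance : IsClosed (N.groupoid.reducedAlgebra : Set N.groupoid.Families) :=
  NonUnitalStarSubalgebra.isClosed_topologicalClosure _

theorem reducedAlgebra_le_range_rhoE : reducedAlgebra S ≤ NonUnitalStarAlgHom.range N.rhoE := by
  refine NonUnitalStarSubalgebra.topologicalClosure_minimal _
    (NonUnitalStarAlgebra.adjoin_le ?_) (isClosed_range_nonUnitalStarAlgHom N.rhoE)
  rintro _ ⟨s, rfl⟩
  exact ⟨⟨_, N.op_mem _⟩, N.rhoEFamilies_op_of s⟩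

theorem rng_fibreEquiv (s : S) : rng (N.fibreEquiv s).1 = Omega.pt s := by
  ext X
  change Omega.act (Hull.of s) (Omega.pt 1) (dom_of s _) X = _
  rw [Bool.eq_iff_iff, Omega.act_apply, Omega.pt_apply, Omega.pt_apply, Hull.mem_preim]
  simp only [Hull.of_apply, _root_.mul_one, Option.some.injEq, exists_eq_right']

theorem isMeagre_singSupport_of_rhoE_eq_zero {a : N.groupoid.reducedAlgebra} (ha : N.rhoE a = 0) :
    IsMeagre (N.groupoid.singSupport a) := by
  have rhoHom_eq_zero : N.groupoid.rhoHom (Omega.pt 1) a = 0 :=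
    (map_eq_zero_iff _ (ell2Congr N.fibreEquiv).symm.conjStarAlgEquiv.injective).1 ha
  have span_le : Submodule.span ℂ (range N.op) ≤ LinearMap.range N.groupoid.regRepₗ :=
    Submodule.span_le.2 (range_subset_iff.2 fun g => ⟨N.bump g 1, rfl⟩)
  refine EtaleGroupoid.isMeagre_singSupport
    (closure_mono span_le (reducedAlgebra_subset_closure_span a.2)) Omega.dense_range_pt
    (disjoint_left.2 (forall_mem_range.2 fun s => ?_))
  rw [← N.rng_fibreEquiv s]
  exact (EtaleGroupoid.rhoHom_eq_zero_iff a.2).1 rhoHom_eq_zero (N.fibreEquiv s)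

theorem rhoEFamilies_delta_apply (a : N.groupoid.Families) (s t : S) :
    N.rhoEFamilies a (delta s) t = N.groupoid.coeff (one (Omega.pt 1))
      (star (N.op (Hull.of t)) * (a * N.op (Hull.of s))) := by
  have op_of_delta_one (s : S) : N.rhoEFamilies (N.op (Hull.of s)) (delta 1) = delta s := by
    rw [rhoEFamilies_op_of, leftReg_delta, _root_.mul_one]
  rw [← rhoEFamilies_delta_one_one, ← inner_delta, ← inner_delta, map_mul, map_mul, map_star,
    mul_apply_eq_comp, mul_apply_eq_comp, ContinuousLinearMap.star_eq_adjoint,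
    ContinuousLinearMap.adjoint_inner_right, op_of_delta_one, op_of_delta_one]

theorem rhoE_eq_zero_of_mem_singularIdeal
    (hfree : ∀ u : Sˣ, u ≠ 1 → ∀ᶠ s in Filter.comap Omega.pt (𝓝 (Omega.pt 1)), (u : S) * s ≠ s)
    {a : N.groupoid.reducedAlgebra} (ha : a ∈ N.groupoid.singularIdeal.toSubmodule) :
    N.rhoE a = 0 := by
  let e (s : S) : N.groupoid.reducedAlgebra := ⟨N.op (Hull.of s), N.op_mem _⟩
  refine Ell2.clm_ext fun s => lp.ext (funext fun t => ?_)
  let b : N.groupoid.reducedAlgebra := star (e t) * (a * e s)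
  have mem_ideal : b ∈ N.groupoid.singularIdeal.toSubmodule :=
    N.groupoid.singularIdeal.mul_mem_left _ _ (N.groupoid.singularIdeal.mul_mem_right _ _ ha)
  exact (N.rhoEFamilies_delta_apply a s t).trans <|
    EtaleGroupoid.coeff_one_eq_zero (𝒢 := N.groupoid) mem_ideal (continuousAt_coeff_one hfree b.2)

end GermSystem

end LCMonoid

theorem proposition2p13_general {S : Type*} [LeftCancelMonoid S]
    (hS : ∀ u : Sˣ, u ≠ 1 → ∃ (m : ℕ) (X : Fin m → LCMonoid.CIdeal S),
      (⋃ i, (X i : Set S)) ≠ Set.univ ∧ ∀ s : S, s ∉ ⋃ i, (X i : Set S) → (u : S) * s ≠ s)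
    (N : LCMonoid.GermSystem S) :
    ∃ Φ : N.groupoid.EssentialAlgebra ≃⋆ₐ[ℂ] LCMonoid.reducedAlgebra S,
      ∀ a : N.groupoid.reducedAlgebra,
        (Φ (N.groupoid.singularIdeal.quotHom a) : Ell2 S →L[ℂ] Ell2 S) = N.rhoE a := by
  have hfree (u : Sˣ) (hu : u ≠ 1) :
      ∀ᶠ s in Filter.comap LCMonoid.Omega.pt (𝓝 (LCMonoid.Omega.pt 1)), (u : S) * s ≠ s := by
    obtain ⟨m, X, hX, hfix⟩ := hS u hu
    exact LCMonoid.Omega.eventually_mul_ne hX hfix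
  let φ := NonUnitalStarAlgHom.codRestrict N.rhoE (LCMonoid.reducedAlgebra S) N.rhoE_mem
  have ker_φ (a) : φ a = 0 ↔ a ∈ N.groupoid.singularIdeal.toSubmodule :=
    ⟨fun h => N.isMeagre_singSupport_of_rhoE_eq_zero (congrArg Subtype.val h),
      fun h => Subtype.ext (N.rhoE_eq_zero_of_mem_singularIdeal hfree h)⟩
  have φ_surjective : Function.Surjective φ := fun T => by
    obtain ⟨a, ha⟩ := N.reducedAlgebra_le_range_rhoE T.2
    exact ⟨a, Subtype.ext ha⟩
  obtain ⟨Φ, hΦ⟩ := N.groupoid.singularIdeal.exists_starAlgEquiv φ ker_φ φ_surjective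
  exact ⟨Φ, fun a => congrArg Subtype.val (hΦ a)⟩

theorem proposition2p13 (S : Type*) [LeftCancelMonoid S] [Countable S]
    (hS : ∀ u : Sˣ, u ≠ 1 → ∃ (m : ℕ) (X : Fin m → LCMonoid.CIdeal S),
      (⋃ i, (X i : Set S)) ≠ Set.univ ∧ ∀ s : S, s ∉ ⋃ i, (X i : Set S) → (u : S) * s ≠ s) :
    (∃ Φ : (LCMonoid.groupoidP S).EssentialAlgebra ≃⋆ₐ[ℂ] LCMonoid.reducedAlgebra S,
      ∀ a : (LCMonoid.groupoidP S).reducedAlgebra,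
        (Φ ((LCMonoid.groupoidP S).singularIdeal.quotHom a) : Ell2 S →L[ℂ] Ell2 S) =
          (LCMonoid.idealSystem S).rhoE a) ∧
    (∃ Φ : (LCMonoid.groupoidQ S).EssentialAlgebra ≃⋆ₐ[ℂ] LCMonoid.reducedAlgebra S,
      ∀ a : (LCMonoid.groupoidQ S).reducedAlgebra,
        (Φ ((LCMonoid.groupoidQ S).singularIdeal.quotHom a) : Ell2 S →L[ℂ] Ell2 S) =
          (LCMonoid.diffSystem S).rhoE a) :=
  ⟨proposition2p13_general hS (LCMonoid.idealSystem S),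
    proposition2p13_general hS (LCMonoid.diffSystem S)⟩
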